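/- Let $d\ge 2$ be an integer, let $[N]=\{1,\dots,N\}$, and let $\log$ be the logarithm to base $2$. All Hilbert spaces are finite-dimensional. **Definitions.** A *BIC-POVM* on $\mathbb{C}^d$ is a family $(\frac1d P_j)_{j=1}^{d^2}$ where $P_1,\dots,P_{d^2}$ are rank-one orthogonal projections that form a basis of $M_d(\mathbb{C})$ and satisfy $\sum_j P_j=dI$. Put $s_{jk}=\operatorname{tr}(P_jP_k)$. In the associated Bell scenario Alice has a setting $(j,k)$ with outcomes $1,2,\perp$ for each pair $j<k$ in $[d^2]$, and a setting $\mathbf{povm}$ with outcomes in $[d^2]$; Bob has settings $j\in[d^2]$ with outcomes $1,\perp$. The Bell function is $$ \begin{aligned} &2\sum_{j<k}\sqrt{1-s_{jk}}\,\bigl[p(1,1|(j,k),j)+p(2,1|(j,k),k)-p(1,1|(j,k),k)-p(2,1|(j,k),j)\bigr]\\ &-\sum_{j<k}(1-s_{jk})\bigl[p_A(1|(j,k))+p_A(2|(j,k))\bigr]-d(d-2)\sum_{j=1}^{d^2}p_B(1|j)-\sum_{j=1}^{d^2}p(j,\perp|\mathbf{povm},j), \end{aligned} $$ where $p_A,p_B$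 are the marginals. A *quantum strategy* in a Bell scenario consists of Hilbert spaces $\mathcal{H}_A,\mathcal{H}_B$, a density matrix $\rho$ on $\mathcal{H}_A\otimes\mathcal{H}_B$, a POVM $(A^x_a)_a$ on $\mathcal{H}_A$ for each setting $x$ of Alice and a POVM $(B^y_b)_b$ on $\mathcal{H}_B$ for each setting $y$ of Bob; its correlation is $p(a,b|x,y)=\operatorname{tr}[(A^x_a\otimes B^y_b)\rho]$. It is locally $d$-dimensional if $\mathcal{H}_A=\mathcal{H}_B=\mathbb{C}^d$, and *optimal* for the Bell function if it attains the largest value among all quantum strategies. A purification of $\rho$ is a vector $|\psi\rangle\in\mathcal{H}_A\otimes\mathcal{H}_B\otimes\mathcal{H}_E$ with $\operatorname{tr}_E|\psi\rangle\langle\psi|=\rho$. For a setting $x$ of Alice put $$\rho^x_{AE}=\sum_a|a\rangle\langle a|\otimes\operatorname{tr}_{AB}\bigl[|\psi\rangle\langle\psi|(A^x_a\otimes I_B\otimes I_E)\bigr],\qquad H(A|E)=H(\rho^x_{AE})-H(\operatorname{tr}_A\rho^x_{AE}),$$ where $H(\tau)=-\operatorname{tr}(\tau\log\tau)$. A set $C$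 of correlations *certifies $r$ bits of device-independent randomness* from the setting $x$ if $H(A|E)\ge r$ for all quantum strategies with correlation in $C$ and all purifications of their states. **Theorem.** 1. There exists a BIC-POVM on $\mathbb{C}^d$. 2. For every BIC-POVM on $\mathbb{C}^d$ the following hold. - The maximum of the Bell function over all quantum strategies is $d^2$, and it is attained by a locally $d$-dimensional strategy. - For every optimal quantum strategy and every purification $|\psi\rangle$ of its state $\rho$ there is a state $\sigma_E$ on $\mathcal{H}_E$ with $$\sum_{j=1}^{d^2}|j\rangle\langle j|\otimes\operatorname{tr}_{AB}\bigl[|\psi\rangle\langle\psi|(A^{\mathbf{povm}}_j\otimes I_B\otimes I_E)\bigr]=\Bigl(\frac1{d^2}\sum_{j=1}^{d^2}|j\rangle\langle j|\Bigr)\otimes\sigma_E ,$$ and consequently $H(A|E)=2\log d$ for this state. - The value $d^2$ of the Bell function certifies $2\log d$ bits of device-independent randomness from the setting $\mathbf{povm}$; moreover $2\log d$ is the minimum of $H(A|E)$ over all quantum strategies of value $d^2$ and all purifications of their states. 3. This is the largest amount possible: in an arbitrary Bell scenario with finitely many outcomes for each setting, if the correlation of a locally $d$-dimensional strategy certifies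 $r$ bits of device-independent randomness from some setting of Alice, then $r\le 2\log d$. -/

import Mathlib

open scoped Kronecker ComplexOrder

noncomputable section

namespace DIRandomness

/-! ### Finite-dimensional quantum mechanics

A finite-dimensional Hilbert space is `ℂ^n` for a finite index type `n`; tensor products are
indexed by product types and operators on them are matrices. -/

section Quantum

variable {m n o : Type} [Fintype m] [Fintype n] [Fintype o]

/-- Density matrices. -/
def IsState (ρ : Matrix n n ℂ) : Prop := ρ.PosSemidef ∧ ρ.trace = 1

/-- Positive operator-valued measures with outcome set `o`. -/
def IsPOVM [DecidableEq n] (M : o → Matrix n n ℂ) : Prop :=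
  (∀ a, (M a).PosSemidef) ∧ ∑ a, M a = 1

/-- Partial trace over the second tensor factor. -/
def traceRight (X : Matrix (m × n) (m × n) ℂ) : Matrix m m ℂ :=
  Matrix.of fun i i' => ∑ k, X (i, k) (i', k)

/-- Partial trace over the first tensor factor. -/
def traceLeft (X : Matrix (m × n) (m × n) ℂ) : Matrix n n ℂ :=
  Matrix.of fun k k' => ∑ i, X (i, k) (i, k')

/-- The rank-one operator `|ψ⟩⟨ψ|`. -/
def ketBra (ψ : n → ℂ) : Matrix n n ℂ := Matrix.vecMulVec ψ (star ψ)

/-- `ψ` is a purification of `ρ`: the partial trace of `|ψ⟩⟨ψ|` over the second factor is `ρ`. -/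
def IsPurification (ψ : m × n → ℂ) (ρ : Matrix m m ℂ) : Prop := traceRight (ketBra ψ) = ρ

open Classical in
/-- The von Neumann entropy `-tr(ρ log₂ ρ)` in bits, through the eigenvalues of the hermitian
matrix `ρ` (and `0` if `ρ` is not hermitian). -/
def entropy (ρ : Matrix n n ℂ) : ℝ :=
  if h : ρ.IsHermitian then ∑ i, Real.negMulLog (h.eigenvalues i) / Real.log 2 else 0

/-- The conditional von Neumann entropy `H(A|E) = H(AE) - H(E)`. -/
def condEntropy (ρ : Matrix (m × n) (m × n) ℂ) : ℝ := entropy ρ - entropy (traceLeft ρ)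

end Quantum

/-! ### Bell scenarios, strategies and device-independent randomness

A bipartite Bell scenario is given by the sets `X`, `Y` of settings and by the finite sets
`OA x`, `OB y` of outcomes. -/

section Scenario

variable {X Y : Type}

/-- Correlations: `p x y a b` is the probability `p(a,b|x,y)`. -/
abbrev Correlation (OA : X → Type) (OB : Y → Type) : Type := ∀ x y, OA x → OB y → ℝ

/-- A quantum strategy: a bipartite mixed state and a POVM for each setting of each party. -/
structure Strategy (OA : X → Type) (OB : Y → Type) [∀ x, Fintype (OA x)] [∀ y, Fintype (OB y)]
    (A B : Type) [Fintype A] [DecidableEq A] [Fintype B] [DecidableEq B] where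
  state : Matrix (A × B) (A × B) ℂ
  alice : ∀ x, OA x → Matrix A A ℂ
  bob : ∀ y, OB y → Matrix B B ℂ
  isState : IsState state
  alice_isPOVM : ∀ x, IsPOVM (alice x)
  bob_isPOVM : ∀ y, IsPOVM (bob y)

variable {OA : X → Type} {OB : Y → Type} [∀ x, Fintype (OA x)] [∀ y, Fintype (OB y)]
  {A B E : Type} [Fintype A] [DecidableEq A] [Fintype B] [DecidableEq B]
  [Fintype E] [DecidableEq E]

/-- The correlation `p(a,b|x,y) = tr[(A^x_a ⊗ B^y_b) ρ]` of a strategy. -/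
def Strategy.correlation (S : Strategy OA OB A B) : Correlation OA OB :=
  fun x y a b => ((S.alice x a ⊗ₖ S.bob y b) * S.state).trace.re

/-- The classical-quantum state `∑ₐ |a⟩⟨a| ⊗ tr_AB[|ψ⟩⟨ψ| (A^x_a ⊗ I_B ⊗ I_E)]` of Alice's outcome
for the setting `x` and the system `E` of the eavesdropper. -/
def Strategy.cqState (S : Strategy OA OB A B) (x : X) [DecidableEq (OA x)]
    (ψ : (A × B) × E → ℂ) : Matrix (OA x × E) (OA x × E) ℂ :=
  ∑ a, Matrix.single a a (1 : ℂ) ⊗ₖ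
    traceLeft (ketBra ψ * ((S.alice x a ⊗ₖ (1 : Matrix B B ℂ)) ⊗ₖ (1 : Matrix E E ℂ)))

/-- All values of the conditional entropy `H(A|E)` of Alice's outcome for the setting `x`, over all
strategies whose correlation lies in `C` and all purifications of their states. -/
def rates (C : Set (Correlation OA OB)) (x : X) [DecidableEq (OA x)] : Set ℝ :=
  {h | ∃ (A B E : Type) (_ : Fintype A) (_ : DecidableEq A) (_ : Fintype B) (_ : DecidableEq B)
      (_ : Fintype E) (_ : DecidableEq E) (S : Strategy OA OB A B) (ψ : (A × B) × E → ℂ),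
      S.correlation ∈ C ∧ IsPurification ψ S.state ∧ h = condEntropy (S.cqState x ψ)}

/-- Observing a correlation in `C` certifies `r` bits of device-independent randomness from the
outcome of the setting `x`. -/
def Certifies (C : Set (Correlation OA OB)) (x : X) [DecidableEq (OA x)] (r : ℝ) : Prop :=
  ∀ h ∈ rates C x, r ≤ h

end Scenario

/-! ### BIC-POVMs and their Bell function -/

/-- `(P_j / d)_j` is a balanced informationally complete POVM on `ℂ^d`. -/
structure IsBICPOVM (d : ℕ) (P : Fin (d ^ 2) → Matrix (Fin d) (Fin d) ℂ) : Prop where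
  isHermitian : ∀ j, (P j).IsHermitian
  idempotent : ∀ j, P j * P j = P j
  rank_eq_one : ∀ j, (P j).rank = 1
  linearIndependent : LinearIndependent ℂ P
  span_eq_top : Submodule.span ℂ (Set.range P) = ⊤
  sum_eq : ∑ j, P j = (d : ℂ) • (1 : Matrix (Fin d) (Fin d) ℂ)

/-- The (real) entries `s_{jk} = tr(P_j P_k)` of the matrix induced by `P`. -/
def overlap {d : ℕ} (P : Fin (d ^ 2) → Matrix (Fin d) (Fin d) ℂ) (j k : Fin (d ^ 2)) : ℝ :=
  (P j * P k).trace.re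

/-- Pairs `(j,k)` with `j < k`. -/
abbrev Pairs (N : ℕ) : Type := {q : Fin N × Fin N // q.1 < q.2}

/-- Alice's settings: one for each pair `j < k`, and the setting `povm`. -/
inductive AliceSetting (d : ℕ) : Type
  | pair (q : Pairs (d ^ 2))
  | povm

/-- Outcomes `1, 2, ⊥` of Alice's pair settings. -/
inductive PairOutcome : Type
  | one
  | two
  | bot
  deriving DecidableEq

instance : Fintype PairOutcome := ⟨{.one, .two, .bot}, fun a => by cases a <;> decide⟩

/-- Outcomes `1, ⊥` of Bob's settings. -/
inductive BobOutcome : Type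
  | one
  | bot
  deriving DecidableEq

instance : Fintype BobOutcome := ⟨{.one, .bot}, fun b => by cases b <;> decide⟩

/-- Alice's outcomes. -/
def AliceOut (d : ℕ) : AliceSetting d → Type
  | .pair _ => PairOutcome
  | .povm => Fin (d ^ 2)

instance (d : ℕ) : (x : AliceSetting d) → Fintype (AliceOut d x)
  | .pair _ => inferInstanceAs (Fintype PairOutcome)
  | .povm => inferInstanceAs (Fintype (Fin (d ^ 2)))

instance (d : ℕ) : (x : AliceSetting d) → DecidableEq (AliceOut d x)
  | .pair _ => inferInstanceAs (DecidableEq PairOutcome)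
  | .povm => inferInstanceAs (DecidableEq (Fin (d ^ 2)))

/-- Bob's settings are the elements of `Fin (d ^ 2)`; each has the outcomes `1, ⊥`. -/
abbrev BobOut (d : ℕ) : Fin (d ^ 2) → Type := fun _ => BobOutcome

/-- The Bell function with parameters `s`. The marginals `p_A(a|(j,k))` and `p_B(1|j)` do not depend
on the setting of the other party for quantum correlations; they are computed with Bob's setting
`j` and with Alice's setting `povm`, respectively. -/
def bellFunction {d : ℕ} (s : Fin (d ^ 2) → Fin (d ^ 2) → ℝ)
    (p : Correlation (AliceOut d) (BobOut d)) : ℝ :=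
  2 * ∑ q : Pairs (d ^ 2), √(1 - s q.1.1 q.1.2) *
      (p (.pair q) q.1.1 PairOutcome.one .one + p (.pair q) q.1.2 PairOutcome.two .one
        - p (.pair q) q.1.2 PairOutcome.one .one - p (.pair q) q.1.1 PairOutcome.two .one)
    - ∑ q : Pairs (d ^ 2), (1 - s q.1.1 q.1.2) *
      (∑ b, p (.pair q) q.1.1 PairOutcome.one b + ∑ b, p (.pair q) q.1.1 PairOutcome.two b)
    - (d : ℝ) * ((d : ℝ) - 2) * ∑ j : Fin (d ^ 2), ∑ a, p .povm j a .one
    - ∑ j : Fin (d ^ 2), p .povm j j .bot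

/-- A quantum strategy for the scenario of this Bell function. -/
abbrev BICStrategy (d : ℕ) (A B : Type) [Fintype A] [DecidableEq A] [Fintype B] [DecidableEq B] :
    Type :=
  Strategy (AliceOut d) (BobOut d) A B

/-- All values of the Bell function attained by quantum strategies. -/
def quantumValues {d : ℕ} (s : Fin (d ^ 2) → Fin (d ^ 2) → ℝ) : Set ℝ :=
  {v | ∃ (A B : Type) (_ : Fintype A) (_ : DecidableEq A) (_ : Fintype B) (_ : DecidableEq B)
      (S : BICStrategy d A B), v = bellFunction s S.correlation}

/-- A strategy is optimal if it attains the largest value among all quantum strategies. -/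
def IsOptimal {d : ℕ} {A B : Type} [Fintype A] [DecidableEq A] [Fintype B] [DecidableEq B]
    (s : Fin (d ^ 2) → Fin (d ^ 2) → ℝ) (S : BICStrategy d A B) : Prop :=
  IsGreatest (quantumValues s) (bellFunction s S.correlation)

/-- The maximally mixed state `(1/d²) ∑ⱼ |j⟩⟨j|` of the outcome register of the setting `povm`. -/
def uniformState (d : ℕ) : Matrix (AliceOut d .povm) (AliceOut d .povm) ℂ :=
  (1 / (d : ℂ) ^ 2) • ∑ j, Matrix.single j j (1 : ℂ)

end DIRandomness

end

open DIRandomness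
open scoped Kronecker

open DIRandomness
open scoped Kronecker ComplexOrder

/-! The upper bound d² comes from a sum of squares. With b_j Bob's effects,
`BellOperators.sq_sub_value` writes d² minus the Bell value as a sum of expectations of positive
operators. At value d² each of these vanishes, and a positive operator with vanishing expectation
annihilates the purified state. Read ψ as a matrix Ψ with rows indexed by AB and columns by E. Then
on Ψ the b_j are idempotent and sum to d, each difference b_j - b_k agrees with an operator of Alice
and satisfies (b_j - b_k)³ = (1 - s_jk)(b_j - b_k), and M_j b_j = M_j for the effects M_j of the
setting `povm`.

Averaging the differences over k gives operators a_j of Alice with a_j Ψ = b_j Ψ. Hence relations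
between the b_j that hold on Ψ hold on the whole module generated from Ψ by the b_j. There the cubic
relation makes T_k = b_j b_k b_j - s_jk b_j satisfy T_k² = (1 - s_jk) T_k, so T_k has nonnegative
expectation. Since ∑_k s_jk = d, the T_k sum to zero, so each vanishes: b_j b_k b_j = s_jk b_j
(`BellRelations.mul_mul_self_of_mem`).

Put f_j = Ψ* b_j Ψ and x_j = Ψ* M_j Ψ. Transfer to Alice makes Ψ* (·) Ψ tracial on Bob's algebra, so
s_jk f_j = s_jk f_k. The graph of nonzero overlaps is connected because the P_j span all matrices,
so f is constant. Moreover f_k = ∑_j s_jk x_j, and the Gram matrix of a basis is nondegenerate, so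
x_j = Ψ*Ψ / d² (`BellRelations.compress_eq`). Up to transposition x_j is Eve's unnormalised state
given the outcome j, so the outcome is uniform and independent of E. The value d² is attained on the
maximally entangled state, with spectral projections of P_j - P_k for Alice.

BIC-POVMs arise as Weyl–Heisenberg orbits of a vector whose ambiguity function has no zeros
(`exists_fiducial`).

For the converse bound, a POVM on ℂ^d is a mixture of POVMs with at most d² nonzero effects
(`IsPOVM.mem_convexHull`). Eve may hold the mixing index while Alice holds a copy of it. The
correlation is unchanged, and given Eve's index the outcome has entropy at most 2 log d. -/

namespace DIRandomness

/-! ### Positive operators and the vectors they annihilate -/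

section Positivity

variable {n E : Type} [Fintype n]

theorem exists_eq_conjTranspose_mul_self {M : Matrix n n ℂ} (hM : M.PosSemidef) :
    ∃ V : Matrix n n ℂ, M = V.conjTranspose * V := by
  classical
  open scoped MatrixOrder in
  exact CStarAlgebra.nonneg_iff_eq_star_mul_self.mp hM.nonneg

theorem exists_eq_mul_conjTranspose_self {M : Matrix n n ℂ} (hM : M.PosSemidef) :
    ∃ V : Matrix n n ℂ, M = V * V.conjTranspose := by
  obtain ⟨V, hV⟩ := exists_eq_conjTranspose_mul_self hM
  exact ⟨V.conjTranspose, by simpa using hV⟩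

theorem trace_mul_self_conjTranspose [Fintype E] (M : Matrix n n ℂ) (Ψ : Matrix n E ℂ) :
    (M * (Ψ * Ψ.conjTranspose)).trace = (Ψ.conjTranspose * M * Ψ).trace := by
  rw [← Matrix.mul_assoc, Matrix.trace_mul_comm, Matrix.mul_assoc]

theorem trace_mul_re_nonneg [Fintype E] {M : Matrix n n ℂ} (hM : M.PosSemidef) (Ψ : Matrix n E ℂ) :
    0 ≤ (M * (Ψ * Ψ.conjTranspose)).trace.re := by
  rw [trace_mul_self_conjTranspose]
  exact (Complex.le_def.1 (hM.conjTranspose_mul_mul_same Ψ).trace_nonneg).1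

/-- With M = V*V the trace is the squared Hilbert–Schmidt norm of VΨ. This turns each vanishing
summand of the sum of squares into an operator relation on the state. -/
theorem mul_eq_zero_of_trace_re_eq_zero [Fintype E] {M : Matrix n n ℂ} (hM : M.PosSemidef)
    {Ψ : Matrix n E ℂ}
    (h : (M * (Ψ * Ψ.conjTranspose)).trace.re = 0) : M * Ψ = 0 := by
  have h0 := (hM.conjTranspose_mul_mul_same Ψ).trace_nonneg
  rw [trace_mul_self_conjTranspose] at h
  have h1 : (Ψ.conjTranspose * M * Ψ).trace = 0 :=
    Complex.ext h (Complex.le_def.1 h0).2.symm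
  obtain ⟨V, rfl⟩ := exists_eq_conjTranspose_mul_self hM
  have h2 : ((V * Ψ).conjTranspose * (V * Ψ)).trace = 0 := by
    rw [← h1, Matrix.conjTranspose_mul]; simp only [Matrix.mul_assoc]
  rw [Matrix.mul_assoc, Matrix.trace_conjTranspose_mul_self_eq_zero_iff.1 h2, Matrix.mul_zero]

theorem mul_eq_zero_of_conjTranspose_mul_mul [Fintype E] {M : Matrix n n ℂ} (hM : M.PosSemidef)
    {Ψ : Matrix n E ℂ} (h : Ψ.conjTranspose * M * Ψ = 0) : M * Ψ = 0 := by
  refine mul_eq_zero_of_trace_re_eq_zero hM ?_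
  rw [trace_mul_self_conjTranspose, h]; simp

theorem posSemidef_mul_self {M : Matrix n n ℂ} (hM : M.IsHermitian) : (M * M).PosSemidef := by
  have := Matrix.posSemidef_conjTranspose_mul_self M
  rwa [hM.eq] at this

theorem posSemidef_of_idempotent {M : Matrix n n ℂ} (hM : M.IsHermitian) (h : M * M = M) :
    M.PosSemidef := h ▸ posSemidef_mul_self hM

theorem mul_eq_zero_of_mul_self_mul {M : Matrix n n ℂ} (hM : M.IsHermitian) {Ψ : Matrix n E ℂ}
    (h : M * M * Ψ = 0) : M * Ψ = 0 := by
  refine Matrix.conjTranspose_mul_self_eq_zero.1 ?_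
  rw [Matrix.conjTranspose_mul, hM.eq, Matrix.mul_assoc, ← Matrix.mul_assoc M M, h, Matrix.mul_zero]

/-- A positive contraction dominates its square. -/
theorem posSemidef_sub_mul_self [DecidableEq n] {M : Matrix n n ℂ} (hM : M.PosSemidef)
    (hM' : (1 - M).PosSemidef) : (M - M * M).PosSemidef := by
  -- M - M² = (1 - M) M (1 - M) + M (1 - M) M.
  have h1 := (hM.conjTranspose_mul_mul_same (1 - M)).add (hM'.conjTranspose_mul_mul_same M)
  rw [hM'.isHermitian.eq, hM.isHermitian.eq] at h1
  convert h1 using 1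
  noncomm_ring

end Positivity

/-! ### Von Neumann entropy of diagonal and product states -/

section Entropy

variable {m n : Type} [Fintype m]

/-- The roots of the characteristic polynomial are the eigenvalues as a multiset, so the entropy can
be computed from any enumeration of them. -/
theorem entropy_eq_of_charpoly [Fintype n] [DecidableEq n] {ρ : Matrix n n ℂ} (hρ : ρ.IsHermitian)
    (f : n → ℝ)
    (h : ρ.charpoly = ∏ i, (Polynomial.X - Polynomial.C (f i : ℂ))) :
    entropy ρ = ∑ i, Real.negMulLog (f i) / Real.log 2 := by
  unfold entropy
  rw [dif_pos hρ]
  have key : Finset.univ.val.map hρ.eigenvalues = Finset.univ.val.map f := by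
    have h1 := hρ.roots_charpoly_eq_eigenvalues
    rw [h, Polynomial.roots_prod _ _
      (by simp [Finset.prod_ne_zero_iff, Polynomial.X_sub_C_ne_zero])] at h1
    have h2 := congrArg (Multiset.map Complex.re) h1
    simpa [Multiset.map_map, Function.comp_def] using h2.symm
  have h3 := congrArg (fun s => (s.map fun x => Real.negMulLog x / Real.log 2).sum) key
  simp only [Multiset.map_map, Function.comp_def] at h3
  convert h3 using 1 <;> congr!

theorem entropy_diagonal [Fintype n] [DecidableEq n] (f : n → ℝ) :
    entropy (Matrix.diagonal fun i => (f i : ℂ)) = ∑ i, Real.negMulLog (f i) / Real.log 2 := by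
  refine entropy_eq_of_charpoly ?_ f (Matrix.charpoly_diagonal _)
  exact Matrix.isHermitian_diagonal_iff.2 fun i => Complex.conj_ofReal _

theorem traceLeft_kronecker (u : Matrix m m ℂ) (σ : Matrix n n ℂ) :
    traceLeft (u ⊗ₖ σ) = u.trace • σ := by
  ext i j
  simp [traceLeft, Matrix.trace, Finset.sum_mul]

/-- Diagonalising σ gives the eigenvalues cλ_i, each repeated `card m` times. Then
`Real.negMulLog_mul` splits the sum, and ∑ λ_i = 1 leaves -log c = log `card m` as the additional
term. -/
theorem entropy_smul_one_kronecker [Fintype n] [DecidableEq m] [DecidableEq n] (c : ℝ)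
    {σ : Matrix n n ℂ}
    (hσ : IsState σ) (hc : c * Fintype.card m = 1) :
    entropy (((c : ℂ) • (1 : Matrix m m ℂ)) ⊗ₖ σ) =
      entropy σ + Real.logb 2 (Fintype.card m) := by
  have hh := hσ.1.isHermitian
  have hU : ((1 : Matrix m m ℂ) ⊗ₖ (hh.eigenvectorUnitary : Matrix n n ℂ)) *
      ((1 : Matrix m m ℂ) ⊗ₖ star (hh.eigenvectorUnitary : Matrix n n ℂ)) = 1 := by
    rw [← Matrix.mul_kronecker_mul, ← Unitary.coe_star, Unitary.coe_mul_star_self]; simp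
  have hσ' : ((c : ℂ) • (1 : Matrix m m ℂ)) ⊗ₖ σ =
      ((1 : Matrix m m ℂ) ⊗ₖ (hh.eigenvectorUnitary : Matrix n n ℂ)) *
      Matrix.diagonal (fun i : m × n => ((c * hh.eigenvalues i.2 : ℝ) : ℂ)) *
      ((1 : Matrix m m ℂ) ⊗ₖ star (hh.eigenvectorUnitary : Matrix n n ℂ)) := by
    have : Matrix.diagonal (fun i : m × n => ((c * hh.eigenvalues i.2 : ℝ) : ℂ)) =
        ((c : ℂ) • (1 : Matrix m m ℂ)) ⊗ₖ
          Matrix.diagonal (RCLike.ofReal ∘ hh.eigenvalues : n → ℂ) := by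
      rw [Matrix.smul_one_eq_diagonal, Matrix.diagonal_kronecker_diagonal]
      simp
    rw [this, ← Matrix.mul_kronecker_mul, ← Matrix.mul_kronecker_mul]
    conv_lhs => rw [hh.spectral_theorem, Unitary.conjStarAlgAut_apply]
    simp
  have hherm : (((c : ℂ) • (1 : Matrix m m ℂ)) ⊗ₖ σ).IsHermitian := by
    rw [Matrix.IsHermitian, Matrix.conjTranspose_kronecker, hh.eq]
    simp
  rw [entropy_eq_of_charpoly hherm (fun i : m × n => c * hh.eigenvalues i.2) ?_,
    entropy_eq_of_charpoly hh hh.eigenvalues hh.charpoly_eq]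
  · rw [Fintype.sum_prod_type]
    have hm : (Fintype.card m : ℝ) ≠ 0 := right_ne_zero_of_mul_eq_one hc
    have hc' : c = (Fintype.card m : ℝ)⁻¹ := eq_inv_of_mul_eq_one_left hc
    have htr : ∑ i, hh.eigenvalues i = 1 := by
      have := hh.trace_eq_sum_eigenvalues
      rw [hσ.2] at this
      exact Complex.ofReal_injective (by simpa using this.symm)
    simp only [Real.negMulLog_mul, Finset.sum_const, Finset.card_univ, nsmul_eq_mul, add_div,
      Finset.sum_add_distrib]
    rw [← Finset.sum_div, ← Finset.sum_mul, htr, Real.logb, mul_add, add_comm]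
    congr 1
    · rw [← Finset.sum_div, ← Finset.mul_sum, ← mul_div_assoc, ← mul_assoc, mul_comm _ c, hc,
        one_mul,
        ← Finset.sum_div]
    · rw [Real.negMulLog, hc', Real.log_inv]
      field_simp
  · rw [hσ', Matrix.charpoly_mul_comm, ← Matrix.mul_assoc, mul_eq_one_comm.1 hU, Matrix.one_mul,
      Matrix.charpoly_diagonal]

end Entropy

/-! ### Bipartite vectors as matrices -/

section Purification

variable {m n : Type}

/-- A vector of `ℂ^m ⊗ ℂ^n` as an `m × n` matrix. -/
def toMatrix (ψ : m × n → ℂ) : Matrix m n ℂ := Matrix.of fun i k => ψ (i, k)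

theorem traceRight_ketBra [Fintype n] (ψ : m × n → ℂ) :
    traceRight (ketBra ψ) = toMatrix ψ * (toMatrix ψ).conjTranspose := by
  ext i j
  simp [traceRight, ketBra, toMatrix, Matrix.mul_apply, Matrix.vecMulVec_apply]

/-- In matrix form Eve's conditional states are compressions Ψ* M Ψ, up to a transposition; all
later statements about E are made for these compressions. -/
theorem traceLeft_ketBra_mul [Fintype m] [Fintype n] [DecidableEq n] (ψ : m × n → ℂ)
    (M : Matrix m m ℂ) :
    traceLeft (ketBra ψ * (M ⊗ₖ (1 : Matrix n n ℂ))) =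
      ((toMatrix ψ).conjTranspose * M * toMatrix ψ).transpose := by
  ext k l
  simp only [traceLeft, ketBra, toMatrix, Matrix.mul_apply, Matrix.vecMulVec_apply,
    Matrix.of_apply, Matrix.transpose_apply, Matrix.conjTranspose_apply, Fintype.sum_prod_type,
    Matrix.kronecker_apply, Matrix.one_apply, Pi.star_apply, mul_ite, mul_one, mul_zero,
    Finset.sum_ite_eq', Finset.mem_univ, if_true]
  refine Finset.sum_congr rfl fun i _ => ?_
  rw [Finset.sum_mul]
  exact Finset.sum_congr rfl fun j _ => by ring

end Purification

/-! ### Decomposition of POVMs into POVMs with few effects -/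

section ExtremalPOVM

variable {o : Type} [Fintype o] {n : Type} [Fintype n]

/-- More than n² matrices are dependent over ℂ. For hermitian matrices the adjoint of a relation is
the relation with conjugate coefficients, so the real and the imaginary parts of the coefficients
are relations too, and one of the two is nonzero. -/
theorem exists_real_relation (M : o → Matrix n n ℂ) (hM : ∀ a, (M a).IsHermitian) (s : Finset o)
    (hs : Fintype.card n ^ 2 < s.card) :
    ∃ c : o → ℝ, (∀ a ∉ s, c a = 0) ∧ c ≠ 0 ∧ ∑ a, c a • M a = 0 := by
  classical
  have h1 : ¬ LinearIndependent ℂ (fun a : s => M a) := fun h => by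
    have := h.fintype_card_le_finrank
    rw [Module.finrank_matrix, Module.finrank_self, Fintype.card_coe] at this
    simp only [mul_one] at this
    rw [sq] at hs
    omega
  obtain ⟨g, hg, a₀, ha₀⟩ := Fintype.not_linearIndependent_iff.1 h1
  set z : o → ℂ := fun a => if h : a ∈ s then g ⟨a, h⟩ else 0 with hz
  have hz0 : ∑ a, z a • M a = 0 := by
    rw [← hg, ← Finset.sum_subset s.subset_univ, ← Finset.sum_coe_sort s]
    · exact Finset.sum_congr rfl fun a _ => by simp [hz]
    · intro a _ ha; simp [hz, ha]
  have hz1 : ∑ a, star (z a) • M a = 0 := by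
    have := congrArg Matrix.conjTranspose hz0
    simpa [Matrix.conjTranspose_sum, (hM _).eq] using this
  have hre : ∑ a, (z a).re • M a = 0 := by
    have : ∑ a, (z a).re • M a = (1 / 2 : ℂ) • (∑ a, z a • M a + ∑ a, star (z a) • M a) := by
      rw [← Finset.sum_add_distrib, Finset.smul_sum]
      refine Finset.sum_congr rfl fun a _ => ?_
      rw [← add_smul, smul_smul, ← Complex.coe_smul, Complex.re_eq_add_conj]
      congr 1
      rw [starRingEnd_apply]; ring
    rw [this, hz0, hz1]; simp
  have him : ∑ a, (z a).im • M a = 0 := by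
    have : ∑ a, (z a).im • M a =
        (1 / (2 * Complex.I) : ℂ) • (∑ a, z a • M a - ∑ a, star (z a) • M a) := by
      rw [← Finset.sum_sub_distrib, Finset.smul_sum]
      refine Finset.sum_congr rfl fun a _ => ?_
      rw [← sub_smul, smul_smul, ← Complex.coe_smul, Complex.im_eq_sub_conj]
      congr 1
      rw [starRingEnd_apply]; ring
    rw [this, hz0, hz1]; simp
  have hza : z a₀ ≠ 0 := by simpa [hz] using ha₀
  by_cases h : (z a₀).re = 0
  · refine ⟨fun a => (z a).im, fun a ha => by simp [hz, ha], fun h0 => hza ?_, him⟩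
    exact Complex.ext h (congrFun h0 a₀)
  · exact ⟨fun a => (z a).re, fun a ha => by simp [hz, ha], fun h0 => h (congrFun h0 a₀), hre⟩

open Classical in
/-- The number of outcomes of a POVM with nonzero effect. -/
noncomputable def supportCard (M : o → Matrix n n ℂ) : ℕ :=
  (Finset.univ.filter fun a => M a ≠ 0).card

/-- Move along the relation until the first weight 1 + t c_a reaches zero, which happens at the
least 1 / (-c_a) over the negative c_a. The condition `hc` guarantees that the effect lost there was
nonzero. -/
theorem IsPOVM.exists_smaller_support [DecidableEq n] {M : o → Matrix n n ℂ} (hM : IsPOVM M)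
    {c : o → ℝ}
    (hc : ∀ a, M a = 0 → c a = 0) (hneg : ∃ a, c a < 0) (hsum : ∑ a, c a • M a = 0) :
    ∃ t : ℝ, 0 < t ∧ IsPOVM (fun a => (1 + t * c a) • M a) ∧
      supportCard (fun a => (1 + t * c a) • M a) < supportCard M := by
  classical
  obtain ⟨a₀, ha₀, hmin⟩ := Finset.exists_min_image (Finset.univ.filter fun a => c a < 0)
    (fun a => 1 / (- c a)) (by simpa [Finset.filter_nonempty_iff] using hneg)
  simp only [Finset.mem_filter, Finset.mem_univ, true_and] at ha₀ hmin
  have ht : 0 < 1 / (- c a₀) := by apply one_div_pos.2; linarith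
  refine ⟨1 / (- c a₀), ht, ⟨fun a => (hM.1 a).smul ?_, ?_⟩, ?_⟩
  · by_cases h : c a < 0
    · have h1 := hmin a h
      have h2 := mul_le_mul_of_nonneg_right h1 (by linarith : 0 ≤ - c a)
      rw [div_mul_cancel₀ 1 (by linarith : - c a ≠ 0)] at h2
      linarith
    · have := mul_nonneg ht.le (not_lt.1 h)
      linarith
  · have : ∀ a, (1 + 1 / (- c a₀) * c a) • M a = M a + (1 / (- c a₀)) • (c a • M a) := fun a => by
      rw [add_smul, one_smul, mul_smul]
    simp only [this, Finset.sum_add_distrib, ← Finset.smul_sum, hsum, hM.2, smul_zero, add_zero]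
  · refine Finset.card_lt_card ⟨fun a => ?_, fun h => ?_⟩
    · simp only [Finset.mem_filter, Finset.mem_univ, true_and]
      exact fun h h0 => h (by rw [h0, smul_zero])
    · have h1 : a₀ ∈ Finset.univ.filter fun a => M a ≠ 0 := by
        simp only [Finset.mem_filter, Finset.mem_univ, true_and]
        exact fun h0 => ha₀.ne (hc _ h0)
      have h2 := h h1
      simp only [Finset.mem_filter, Finset.mem_univ, true_and] at h2
      apply h2
      rw [one_div, inv_neg, neg_mul, inv_mul_cancel₀ ha₀.ne, add_neg_cancel, zero_smul]

/-- A POVM on `ℂ^n` is a mixture of POVMs with at most `n²` nonzero effects. -/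
theorem IsPOVM.mem_convexHull [DecidableEq n] (M : o → Matrix n n ℂ) (hM : IsPOVM M) :
    M ∈ convexHull ℝ {N : o → Matrix n n ℂ | IsPOVM N ∧ supportCard N ≤ Fintype.card n ^ 2} := by
  classical
  induction hk : supportCard M using Nat.strong_induction_on generalizing M with
  | _ k ih =>
    by_cases hle : supportCard M ≤ Fintype.card n ^ 2
    · exact subset_convexHull _ _ ⟨hM, hle⟩
    obtain ⟨c, hc, hc0, hsum⟩ := exists_real_relation M (fun a => (hM.1 a).isHermitian)
      (Finset.univ.filter fun a => M a ≠ 0) (not_le.1 hle)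
    have hc' : ∀ a, M a = 0 → c a = 0 := fun a ha => hc a (by simp [ha])
    have htr : ∑ a, c a * (M a).trace.re = 0 := by
      have := congrArg (fun X => (Matrix.trace X).re) hsum
      simpa [Matrix.trace_sum, Matrix.trace_smul] using this
    have hpos : ∀ a, M a ≠ 0 → 0 < (M a).trace.re := fun a ha => by
      have h1 := Complex.le_def.1 (hM.1 a).trace_nonneg
      refine lt_of_le_of_ne h1.1 fun h => ha ?_
      have := mul_eq_zero_of_trace_re_eq_zero (hM.1 a) (Ψ := (1 : Matrix n n ℂ))
        (by simpa using h.symm)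
      simpa using this
    -- The traces are positive on the support, so a nontrivial relation has a negative coefficient.
    -- Applied to c and to -c, this allows a move in both directions.
    have hsign : ∀ e : o → ℝ, (∀ a, M a = 0 → e a = 0) → e ≠ 0 →
        ∑ a, e a * (M a).trace.re = 0 → ∃ a, e a < 0 := by
      intro e he he0 hes
      by_contra! hcon
      have h1 := (Finset.sum_eq_zero_iff_of_nonneg fun a _ =>
        mul_nonneg (hcon a) (Complex.le_def.1 (hM.1 a).trace_nonneg).1).1 hes
      refine he0 (funext fun a => ?_)
      by_cases ha : M a = 0
      · exact he a ha
      · exact (mul_eq_zero.1 (h1 a (Finset.mem_univ a))).resolve_right (hpos a ha).ne'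
    obtain ⟨t, ht, hN, hNs⟩ := hM.exists_smaller_support hc' (hsign c hc' hc0 htr) hsum
    obtain ⟨u, hu, hN', hNs'⟩ := hM.exists_smaller_support (c := fun a => - c a)
      (fun a ha => by simp [hc' a ha])
      (hsign (fun a => - c a) (fun a ha => by simp [hc' a ha])
        (fun h => hc0 (funext fun a => by simpa using congrFun h a)) (by simp [htr]))
      (by simp [hsum])
    have h1 := ih _ (hk ▸ hNs) _ hN rfl
    have h2 := ih _ (hk ▸ hNs') _ hN' rfl
    -- M lies between the endpoints at the parameters t and -u, and the weights u/(t+u) and t/(t+u)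
    -- cancel the terms linear in c.
    have hcomb : M = (u / (t + u)) • (fun a => (1 + t * c a) • M a) +
        (t / (t + u)) • (fun a => (1 + u * - c a) • M a) := by
      funext a
      simp only [Pi.add_apply, Pi.smul_apply, smul_smul, ← add_smul]
      have : u / (t + u) * (1 + t * c a) + t / (t + u) * (1 + u * - c a) = 1 := by
        field_simp; ring
      rw [this, one_smul]
    rw [hcomb]
    exact convex_convexHull ℝ _ h1 h2 (by positivity) (by positivity) (by field_simp; ring)

end ExtremalPOVM

/-! ### Shannon entropy of distributions with small support -/

section ClassicalEntropy

variable {o : Type} [Fintype o]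

/-- Jensen's inequality for the uniform weights on s. The total mass is left free, so that the bound
can be applied for each value of the eavesdropper and then summed. -/
theorem sum_negMulLog_le {p : o → ℝ} (hp : ∀ a, 0 ≤ p a) {s : Finset o} (hs : ∀ a ∉ s, p a = 0)
    {K : ℝ} (hK : (s.card : ℝ) ≤ K) :
    ∑ a, Real.negMulLog (p a) ≤ Real.negMulLog (∑ a, p a) + (∑ a, p a) * Real.log K := by
  rw [← Finset.sum_subset s.subset_univ fun a _ ha => by simp [hs a ha],
    ← Finset.sum_subset s.subset_univ fun a _ ha => hs a ha]
  rcases s.eq_empty_or_nonempty with rfl | hne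
  · simp
  have hn : (0 : ℝ) < s.card := by exact_mod_cast hne.card_pos
  have hj := Real.concaveOn_negMulLog.le_map_sum (t := s) (w := fun _ => (s.card : ℝ)⁻¹) (p := p)
    (fun _ _ => by positivity) (by simp [hn.ne']) (fun a _ => hp a)
  simp only [smul_eq_mul, ← Finset.mul_sum] at hj
  rw [mul_comm _ (∑ a ∈ s, p a), Real.negMulLog_mul, inv_mul_le_iff₀ hn] at hj
  have hq : 0 ≤ ∑ a ∈ s, p a := Finset.sum_nonneg fun a _ => hp a
  have h1 : (s.card : ℝ) * ((s.card : ℝ)⁻¹ * Real.negMulLog (∑ a ∈ s, p a) +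
      (∑ a ∈ s, p a) * Real.negMulLog (s.card : ℝ)⁻¹) =
      Real.negMulLog (∑ a ∈ s, p a) + (∑ a ∈ s, p a) * Real.log s.card := by
    rw [Real.negMulLog, Real.negMulLog, Real.log_inv]; field_simp
  rw [h1] at hj
  have h2 := mul_le_mul_of_nonneg_left (Real.log_le_log hn hK) hq
  linarith

end ClassicalEntropy

/-! ### Strategies in which Alice holds a copy of Eve's register -/

section ClassicalEavesdropper

variable {X Y : Type} {OA : X → Type} {OB : Y → Type} [∀ x, Fintype (OA x)] [∀ y, Fintype (OB y)]
  {A B E : Type} [Fintype A] [DecidableEq A] [Fintype B] [DecidableEq B]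
  [Fintype E] [DecidableEq E]

theorem IsPOVM.blockDiagonal {o : Type} [Fintype o] {N : E → o → Matrix A A ℂ}
    (hN : ∀ e, IsPOVM (N e)) : IsPOVM fun a => Matrix.blockDiagonal fun e => N e a := by
  constructor
  · intro a
    choose V hV using fun e => exists_eq_conjTranspose_mul_self ((hN e).1 a)
    have : Matrix.blockDiagonal (fun e => N e a) =
        (Matrix.blockDiagonal V).conjTranspose * Matrix.blockDiagonal V := by
      rw [Matrix.blockDiagonal_conjTranspose, ← Matrix.blockDiagonal_mul]
      congr 1
      exact funext hV
    simp only [this]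
    exact Matrix.posSemidef_conjTranspose_mul_self _
  · ext ⟨i, e⟩ ⟨j, e'⟩
    rw [Matrix.sum_apply]
    simp only [Matrix.blockDiagonal_apply]
    by_cases h : e = e'
    · subst h
      have := congrFun (congrFun (hN e).2 i) j
      rw [Matrix.sum_apply] at this
      simpa [Matrix.one_apply] using this
    · simp [h]

/-- The vector `∑ₑ wₑ ⊗ |e⟩_A ⊗ |e⟩_E`, in which Alice holds a copy of the register of the
eavesdropper. -/
def copyVector (w : E → A × B → ℂ) : ((A × E) × B) × E → ℂ :=
  fun z => if z.1.1.2 = z.2 then w z.2 (z.1.1.1, z.1.2) else 0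

/-- Alice's operators are block diagonal in her copy of the register, so no coherence between
different values of e survives and Eve's conditional states are classical. -/
theorem copyVector_compress {A B E : Type} [Fintype A] [Fintype B] [Fintype E] [DecidableEq E]
    (w : E → A × B → ℂ) (N : E → Matrix A A ℂ) (M : Matrix B B ℂ) :
    (toMatrix (copyVector w)).conjTranspose * (Matrix.blockDiagonal N ⊗ₖ M) *
      toMatrix (copyVector w) = Matrix.diagonal fun e => star (w e) ⬝ᵥ
        ((N e ⊗ₖ M).mulVec (w e)) := by
  ext e e'
  rw [Matrix.mul_assoc, Matrix.diagonal_apply]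
  have h : ∀ a f b, ((Matrix.blockDiagonal N ⊗ₖ M) * toMatrix (copyVector w)) ((a, f), b) e' =
      if f = e' then ((N f ⊗ₖ M).mulVec (w e')) (a, b) else 0 := by
    intro a f b
    simp only [Matrix.mul_apply, toMatrix, copyVector, Matrix.of_apply, Fintype.sum_prod_type,
      Matrix.kronecker_apply, Matrix.blockDiagonal_apply, Matrix.mulVec, dotProduct]
    by_cases hf : f = e'
    · subst hf
      simp only [if_true]
      refine Finset.sum_congr rfl fun a' _ => ?_
      rw [Finset.sum_eq_single f]
      · simp
      · intro g _ hg; simp [hg]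
      · simp
    · rw [if_neg hf]
      refine Finset.sum_eq_zero fun a' _ => Finset.sum_eq_zero fun g _ =>
        Finset.sum_eq_zero fun b' _ => ?_
      by_cases hg : g = e'
      · subst hg; simp [hf]
      · simp [hg]
  rw [Matrix.mul_apply, Fintype.sum_prod_type, Fintype.sum_prod_type]
  simp only [h, Matrix.conjTranspose_apply]
  simp only [toMatrix, copyVector, Matrix.of_apply]
  by_cases he : e = e'
  · subst he
    rw [if_pos rfl, dotProduct, Fintype.sum_prod_type]
    refine Finset.sum_congr rfl fun a' _ => ?_
    rw [Finset.sum_eq_single e]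
    · simp
    · intro g _ hg; simp [hg]
    · simp
  · rw [if_neg he]
    refine Finset.sum_eq_zero fun a' _ => Finset.sum_eq_zero fun g _ =>
      Finset.sum_eq_zero fun b' _ => ?_
    by_cases hg : g = e'
    · subst hg; simp [Ne.symm he]
    · simp [hg]

theorem blockDiagonal_one_kronecker {A B E : Type} [DecidableEq A] [DecidableEq B]
    [DecidableEq E] :
    (Matrix.blockDiagonal fun _ : E => (1 : Matrix A A ℂ)) ⊗ₖ (1 : Matrix B B ℂ) = 1 := by
  have : (Matrix.blockDiagonal fun _ : E => (1 : Matrix A A ℂ)) = 1 :=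
    Matrix.blockDiagonal_one
  rw [this, Matrix.one_kronecker_one]

/-- The strategy in which Alice reads her copy `e` of the eavesdropper's register and measures
with `N x e`. -/
def copyStrategy (w : E → A × B → ℂ) (hw : ∑ e, star (w e) ⬝ᵥ w e = 1)
    (N : ∀ x, E → OA x → Matrix A A ℂ) (hN : ∀ x e, IsPOVM (N x e))
    (M : ∀ y, OB y → Matrix B B ℂ) (hM : ∀ y, IsPOVM (M y)) : Strategy OA OB (A × E) B where
  state := traceRight (ketBra (copyVector w))
  alice x a := Matrix.blockDiagonal fun e => N x e a
  bob := M
  isState := by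
    rw [traceRight_ketBra]
    refine ⟨Matrix.posSemidef_self_mul_conjTranspose _, ?_⟩
    have := copyVector_compress w (fun _ => 1) 1
    rw [blockDiagonal_one_kronecker, Matrix.mul_one] at this
    rw [Matrix.trace_mul_comm, this, Matrix.trace_diagonal]
    simpa using hw
  alice_isPOVM x := IsPOVM.blockDiagonal (hN x)
  bob_isPOVM := hM

variable {w : E → A × B → ℂ} {hw : ∑ e, star (w e) ⬝ᵥ w e = 1}
    {N : ∀ x, E → OA x → Matrix A A ℂ} {hN : ∀ x e, IsPOVM (N x e)}
    {M : ∀ y, OB y → Matrix B B ℂ} {hM : ∀ y, IsPOVM (M y)}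

theorem copyStrategy_correlation (x : X) (y : Y) (a : OA x) (b : OB y) :
    (copyStrategy w hw N hN M hM).correlation x y a b =
      (∑ e, star (w e) ⬝ᵥ ((N x e a ⊗ₖ M y b).mulVec (w e))).re := by
  simp only [Strategy.correlation, copyStrategy]
  rw [traceRight_ketBra, trace_mul_self_conjTranspose, copyVector_compress, Matrix.trace_diagonal]

theorem dotProduct_mulVec_eq_ofReal {n : Type} [Fintype n] {Q : Matrix n n ℂ} (hQ : Q.PosSemidef)
    (v : n → ℂ) :
    star v ⬝ᵥ Q.mulVec v = ((star v ⬝ᵥ Q.mulVec v).re : ℂ) := by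
  have h := Complex.le_def.1 (hQ.dotProduct_mulVec_nonneg v)
  exact Complex.ext rfl h.2.symm

/-- The classical-quantum state is diagonal, so the quantity is a classical conditional entropy. For
each e at most K outcomes have nonzero weight, and the masses of the values e sum to one. -/
theorem copyStrategy_condEntropy_le (x : X) [DecidableEq (OA x)] {K : ℕ}
    (hK : ∀ e, supportCard (N x e) ≤ K) :
    condEntropy ((copyStrategy w hw N hN M hM).cqState x (copyVector w)) ≤ Real.logb 2 K := by
  classical
  set p : OA x × E → ℝ := fun z =>
    (star (w z.2) ⬝ᵥ ((N x z.2 z.1 ⊗ₖ (1 : Matrix B B ℂ)).mulVec (w z.2))).re with hp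
  have hpsd : ∀ a e, (N x e a ⊗ₖ (1 : Matrix B B ℂ)).PosSemidef := fun a e =>
    ((hN x e).1 a).kronecker Matrix.PosSemidef.one
  have hcq : (copyStrategy w hw N hN M hM).cqState x (copyVector w) =
      Matrix.diagonal fun z => (p z : ℂ) := by
    simp only [Strategy.cqState, copyStrategy, traceLeft_ketBra_mul, copyVector_compress]
    ext ⟨a, e⟩ ⟨a', e'⟩
    rw [Matrix.sum_apply]
    simp only [Matrix.kronecker_apply, Matrix.single_apply, Matrix.transpose_apply,
      Matrix.diagonal_apply, Prod.mk.injEq]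
    rw [Finset.sum_eq_single a]
    · by_cases ha : a = a'
      · by_cases he : e = e'
        · subst ha he
          simpa [hp] using dotProduct_mulVec_eq_ofReal (hpsd a e) (w e)
        · simp [he, Ne.symm he]
      · simp [ha]
    · intro c _ hc; simp [hc]
    · simp
  have htl : traceLeft (Matrix.diagonal fun z : OA x × E => (p z : ℂ)) =
      Matrix.diagonal fun e => ((∑ a, p (a, e) : ℝ) : ℂ) := by
    ext e e'
    simp only [traceLeft, Matrix.of_apply, Matrix.diagonal_apply, Prod.mk.injEq, true_and]
    by_cases he : e = e' <;> simp [he]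
  have hp0 : ∀ z, 0 ≤ p z := fun z =>
    (Complex.le_def.1 ((hpsd z.1 z.2).dotProduct_mulVec_nonneg (w z.2))).1
  have hsum : ∑ e, ∑ a, p (a, e) = 1 := by
    have h1 : ∀ e, ∑ a, p (a, e) = (star (w e) ⬝ᵥ w e).re := fun e => by
      simp only [hp]
      rw [← Complex.re_sum, ← dotProduct_sum, ← Matrix.sum_mulVec]
      have : ∑ a, N x e a ⊗ₖ (1 : Matrix B B ℂ) = 1 := by
        rw [← Matrix.one_kronecker_one, ← (hN x e).2]
        ext i j
        simp [Matrix.sum_apply, Finset.sum_mul]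
      rw [this, Matrix.one_mulVec]
    simp only [h1]
    rw [← Complex.re_sum, hw, Complex.one_re]
  rw [condEntropy, hcq, htl, entropy_diagonal, entropy_diagonal, ← Finset.sum_div, ← Finset.sum_div,
    ← sub_div, Real.logb]
  refine div_le_div_of_nonneg_right ?_ (Real.log_nonneg (by norm_num))
  rw [sub_le_iff_le_add, Fintype.sum_prod_type_right, ← one_mul (Real.log K), ← hsum,
    Finset.sum_mul, ← Finset.sum_add_distrib]
  refine Finset.sum_le_sum fun e _ => ?_
  rw [add_comm]
  refine sum_negMulLog_le (fun a => hp0 (a, e)) (s := Finset.univ.filter fun a => N x e a ≠ 0) ?_ ?_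
  · intro a ha
    have : N x e a = 0 := by simpa using ha
    simp [hp, this]
  · exact_mod_cast hK e

end ClassicalEavesdropper

/-! ### At most two bits of randomness per bit of local dimension -/

section UpperBound

/-- The correlation of a locally `n`-dimensional strategy certifies at most `2 log n` bits. -/
theorem Certifies.le_two_mul_logb {X Y : Type} {OA : X → Type} {OB : Y → Type}
    [∀ x, Fintype (OA x)] [∀ y, Fintype (OB y)] {A B : Type} [Fintype A] [DecidableEq A]
    [Fintype B] [DecidableEq B] (S : Strategy OA OB A B) (x : X) [DecidableEq (OA x)] {r : ℝ}
    (h : Certifies {S.correlation} x r) : r ≤ 2 * Real.logb 2 (Fintype.card A) := by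
  classical
  obtain ⟨Λ, _, q, N₀, hq0, hq1, hN₀, hmix⟩ :=
    mem_convexHull_iff_exists_fintype.1 (IsPOVM.mem_convexHull (S.alice x) (S.alice_isPOVM x))
  -- The columns of V form an ensemble of pure states for ρ; Eve's register will contain the column
  -- index as well as the index of the mixture.
  obtain ⟨V, hV⟩ := exists_eq_mul_conjTranspose_self S.isState.1
  -- Only the setting x is split into POVMs of small support; the others ignore the register.
  set N₁ : ∀ x', Λ → OA x' → Matrix A A ℂ :=
    Function.update (fun x' _ a => S.alice x' a) x N₀ with hN₁
  have hpovm : ∀ x' l, IsPOVM (N₁ x' l) := by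
    intro x' l
    by_cases hx : x' = x
    · subst hx; simpa [hN₁] using (hN₀ l).1
    · simpa [hN₁, hx] using S.alice_isPOVM x'
  have hmix' : ∀ x' a, ∑ l, q l • N₁ x' l a = S.alice x' a := by
    intro x' a
    by_cases hx : x' = x
    · subst hx
      have := congrFun hmix a
      simpa [hN₁, Finset.sum_apply] using this
    · simp [hN₁, hx, ← Finset.sum_smul, hq1]
  set w : (A × B) × Λ → A × B → ℂ := fun e i => (√(q e.2) : ℂ) * V i e.1 with hw
  have hexp : ∀ Q : Λ → Matrix (A × B) (A × B) ℂ, ∑ e, star (w e) ⬝ᵥ ((Q e.2).mulVec (w e)) =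
      ((∑ l, q l • Q l) * S.state).trace := by
    intro Q
    have h1 : ∀ e, star (w e) ⬝ᵥ ((Q e.2).mulVec (w e)) =
        (q e.2 : ℂ) * (V.conjTranspose * Q e.2 * V) e.1 e.1 := by
      intro e
      have hwe : w e = (√(q e.2) : ℂ) • V.col e.1 := by ext i; simp [hw, Matrix.col]
      have hsq : ((√(q e.2) : ℝ) : ℂ) * ((√(q e.2) : ℝ) : ℂ) = (q e.2 : ℂ) := by
        rw [← Complex.ofReal_mul, Real.mul_self_sqrt (hq0 _)]
      rw [hwe, Matrix.mulVec_smul, star_smul, smul_dotProduct, dotProduct_smul, smul_smul,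
        smul_eq_mul]
      have : star (V.col e.1) ⬝ᵥ (Q e.2).mulVec (V.col e.1) =
          (V.conjTranspose * Q e.2 * V) e.1 e.1 := by
        rw [Matrix.mul_assoc, Matrix.mul_apply]
        rfl
      rw [this, ← hsq]
      simp
    rw [Finset.sum_congr rfl fun e _ => h1 e, Fintype.sum_prod_type_right, Finset.sum_mul,
      Matrix.trace_sum]
    refine Finset.sum_congr rfl fun l _ => ?_
    dsimp only
    rw [← Finset.mul_sum, Matrix.smul_mul, Matrix.trace_smul, hV, trace_mul_self_conjTranspose]
    simp [Matrix.trace]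
  have hnorm : ∑ e, star (w e) ⬝ᵥ w e = 1 := by
    have := hexp fun _ => 1
    rw [← Finset.sum_smul, hq1, one_smul, Matrix.one_mul, S.isState.2] at this
    simpa using this
  have hcorr : (copyStrategy w hnorm (fun x' e => N₁ x' e.2) (fun x' e => hpovm x' e.2) S.bob
      S.bob_isPOVM).correlation = S.correlation := by
    funext x' y a b
    rw [copyStrategy_correlation, hexp fun l => N₁ x' l a ⊗ₖ S.bob y b, Strategy.correlation,
      ← hmix' x' a]
    congr 3
    ext i j
    simp [Matrix.sum_apply, Finset.sum_mul, mul_assoc]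
  -- The state of the copy strategy is defined as the partial trace of its vector, so the
  -- purification condition holds by `rfl`.
  have hrate := h _ ⟨A × ((A × B) × Λ), B, (A × B) × Λ, inferInstance, inferInstance, inferInstance,
    inferInstance, inferInstance, inferInstance, copyStrategy w hnorm (fun x' e => N₁ x' e.2)
      (fun x' e => hpovm x' e.2) S.bob S.bob_isPOVM, copyVector w, hcorr, rfl, rfl⟩
  refine hrate.trans
    ((copyStrategy_condEntropy_le x (K := Fintype.card A ^ 2) fun e => ?_).trans ?_)
  · simpa [hN₁] using (hN₀ e.2).2
  · rw [Nat.cast_pow, Real.logb_pow]; norm_num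

end UpperBound

theorem exists_eq_vecMulVec_of_rank_eq_one {n : Type} [Fintype n] {M : Matrix n n ℂ}
    (h : M.rank = 1) : ∃ u v : n → ℂ, M = Matrix.vecMulVec u v := by
  classical
  obtain ⟨u, -, hu⟩ := finrank_eq_one_iff'.1 h
  choose c hc using fun j => hu ⟨M.mulVec (Pi.single j 1), ⟨Pi.single j 1, rfl⟩⟩
  refine ⟨u, c, ?_⟩
  ext i j
  have := congrFun (congrArg Subtype.val (hc j)) i
  simp only [Submodule.coe_smul, Pi.smul_apply, smul_eq_mul, Matrix.mulVec_single_one,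
    Matrix.col_apply] at this
  rw [Matrix.vecMulVec_apply, ← this, mul_comm]

/-! ### Overlaps of a BIC-POVM: connectedness and nondegeneracy -/

namespace IsBICPOVM

variable {d : ℕ} {P : Fin (d ^ 2) → Matrix (Fin d) (Fin d) ℂ}

theorem overlap_comm (j k : Fin (d ^ 2)) : overlap P j k = overlap P k j := by
  rw [overlap, Matrix.trace_mul_comm, overlap]

theorem mul_mul_self (hP : IsBICPOVM d P) (j : Fin (d ^ 2)) (X : Matrix (Fin d) (Fin d) ℂ) :
    P j * X * P j = (P j * X).trace • P j := by
  obtain ⟨u, v, h⟩ := exists_eq_vecMulVec_of_rank_eq_one (hP.rank_eq_one j)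
  rw [h, Matrix.vecMulVec_mul, Matrix.vecMulVec_mul_vecMulVec, Matrix.trace_vecMulVec,
    dotProduct_comm, Matrix.vecMulVec_smul]

theorem ne_zero (hP : IsBICPOVM d P) (j : Fin (d ^ 2)) : P j ≠ 0 := fun h => by
  have := hP.rank_eq_one j
  rw [h, Matrix.rank_zero] at this
  exact zero_ne_one this

theorem trace_eq_one (hP : IsBICPOVM d P) (j : Fin (d ^ 2)) : (P j).trace = 1 := by
  have h := hP.mul_mul_self j 1
  rw [Matrix.mul_one, hP.idempotent] at h
  have h1 : ((P j).trace - 1) • P j = 0 := by rw [sub_smul, one_smul, ← h, sub_self]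
  exact sub_eq_zero.1 ((smul_eq_zero.1 h1).resolve_right (hP.ne_zero j))

theorem trace_mul (hP : IsBICPOVM d P) (j k : Fin (d ^ 2)) : (P j * P k).trace =
    (overlap P j k : ℂ) := by
  refine Complex.ext rfl ?_
  have h : star (P j * P k).trace = (P j * P k).trace := by
    rw [← Matrix.trace_conjTranspose, Matrix.conjTranspose_mul, (hP.isHermitian j).eq,
      (hP.isHermitian k).eq, Matrix.trace_mul_comm]
  exact Complex.conj_eq_iff_im.1 h

theorem mul_mul_self_eq_overlap (hP : IsBICPOVM d P) (j k : Fin (d ^ 2)) :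
    P j * P k * P j = (overlap P j k : ℂ) • P j := by
  rw [hP.mul_mul_self, hP.trace_mul]

theorem overlap_self (hP : IsBICPOVM d P) (j : Fin (d ^ 2)) : overlap P j j = 1 := by
  rw [overlap, hP.idempotent, hP.trace_eq_one, Complex.one_re]

theorem sum_overlap (hP : IsBICPOVM d P) (j : Fin (d ^ 2)) : ∑ k, overlap P j k = d := by
  simp only [overlap]
  rw [← Complex.re_sum, ← Matrix.trace_sum, ← Matrix.mul_sum, hP.sum_eq]
  simp [hP.trace_eq_one]

theorem trace_sub_mul_self (hP : IsBICPOVM d P) (j k : Fin (d ^ 2)) :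
    ((P j - P k) * (P j - P k)).trace = 2 * (1 - overlap P j k : ℂ) := by
  have : (P j - P k) * (P j - P k) = P j * P j + P k * P k - P j * P k - P k * P j := by
    noncomm_ring
  rw [this, hP.idempotent, hP.idempotent, Matrix.trace_sub, Matrix.trace_sub, Matrix.trace_add,
    hP.trace_mul, hP.trace_mul, hP.trace_eq_one, hP.trace_eq_one, overlap_comm k j]
  ring

/-- The trace of (P_j - P_k)² is 2(1 - s_jk), and it vanishes only if P_j = P_k, which linear
independence excludes. -/
theorem overlap_lt_one (hP : IsBICPOVM d P) {j k : Fin (d ^ 2)} (hjk : j ≠ k) :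
    overlap P j k < 1 := by
  have hh : (P j - P k).IsHermitian := (hP.isHermitian j).sub (hP.isHermitian k)
  have h0 := (posSemidef_mul_self hh).trace_nonneg
  rw [hP.trace_sub_mul_self] at h0
  have h1 : 0 ≤ 2 * (1 - overlap P j k) := by exact_mod_cast h0
  refine lt_of_le_of_ne (by linarith) fun h => hjk (hP.linearIndependent.injective ?_)
  have h2 := hP.trace_sub_mul_self j k
  rw [h, Complex.ofReal_one, sub_self, mul_zero] at h2
  have h3 : ((P j - P k).conjTranspose * (P j - P k)).trace = 0 := by rw [hh.eq, h2]
  exact sub_eq_zero.1 (Matrix.trace_conjTranspose_mul_self_eq_zero_iff.1 h3)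

theorem mul_eq_zero_of_overlap (hP : IsBICPOVM d P) {j k : Fin (d ^ 2)} (h : overlap P j k = 0) :
    P k * P j = 0 := by
  refine Matrix.conjTranspose_mul_self_eq_zero.1 ?_
  rw [Matrix.conjTranspose_mul, (hP.isHermitian j).eq, (hP.isHermitian k).eq, Matrix.mul_assoc,
    ← Matrix.mul_assoc (P k), hP.idempotent, ← Matrix.mul_assoc, hP.mul_mul_self_eq_overlap, h]
  simp

/-- The graph of nonvanishing overlaps is connected. -/
theorem eq_of_overlap_mul_sub_eq_zero (hP : IsBICPOVM d P) {b : Fin (d ^ 2) → ℂ}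
    (hb : ∀ j k, (overlap P j k : ℂ) * (b j - b k) = 0) (j k : Fin (d ^ 2)) : b j = b k := by
  by_contra hjk
  have hz : ∀ l m, b l ≠ b m → P l * P m = 0 := fun l m hlm => by
    apply hP.mul_eq_zero_of_overlap
    exact_mod_cast (mul_eq_zero.1 (hb m l)).resolve_right (sub_ne_zero.2 (Ne.symm hlm))
  -- Each b_l differs from b_j or from b_k, so P_k P_l P_j = 0 for every l, and the P_l span all
  -- matrices. A matrix unit as X then contradicts that P_j and P_k are nonzero.
  have h1 : ∀ X, P k * X * P j = 0 := by
    intro X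
    have hX : X ∈ Submodule.span ℂ (Set.range P) := hP.span_eq_top ▸ Submodule.mem_top
    induction hX using Submodule.span_induction with
    | mem x hx =>
      obtain ⟨l, rfl⟩ := hx
      by_cases hl : b k = b l
      · rw [Matrix.mul_assoc, hz l j (fun h => hjk (hl.trans h).symm), Matrix.mul_zero]
      · rw [hz k l hl, Matrix.zero_mul]
    | zero => simp
    | add x y _ _ hx hy => rw [Matrix.mul_add, Matrix.add_mul, hx, hy, add_zero]
    | smul c x _ hx => rw [Matrix.mul_smul, Matrix.smul_mul, hx, smul_zero]
  obtain ⟨i, a, hia⟩ : ∃ i a, P k i a ≠ 0 := by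
    by_contra! h; exact hP.ne_zero k (by ext i a; simpa using h i a)
  obtain ⟨c, l, hcl⟩ : ∃ c l, P j c l ≠ 0 := by
    by_contra! h; exact hP.ne_zero j (by ext i a; simpa using h i a)
  have h2 := congrFun (congrFun (h1 (Matrix.single a c 1)) i) l
  rw [Matrix.mul_apply, Finset.sum_eq_single c] at h2
  · simp at h2
    tauto
  · intro e _ he
    rw [Matrix.mul_single_apply_of_ne _ _ _ _ _ he, zero_mul]
  · simp

/-- The Gram matrix of the basis `P` is nondegenerate. -/
theorem eq_zero_of_sum_overlap_mul (hP : IsBICPOVM d P) {x : Fin (d ^ 2) → ℂ}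
    (hx : ∀ k, ∑ j, (overlap P j k : ℂ) * x j = 0) : x = 0 := by
  set Z := ∑ j, x j • P j with hZ
  -- The hypothesis says that Z is trace-orthogonal to every P_l, hence to all matrices, in
  -- particular to its own adjoint.
  have h1 : ∀ X, (Z * X).trace = 0 := by
    intro X
    have hX : X ∈ Submodule.span ℂ (Set.range P) := hP.span_eq_top ▸ Submodule.mem_top
    induction hX using Submodule.span_induction with
    | mem y hy =>
      obtain ⟨l, rfl⟩ := hy
      rw [hZ, Finset.sum_mul, Matrix.trace_sum, ← hx l]
      refine Finset.sum_congr rfl fun j _ => ?_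
      rw [Matrix.smul_mul, Matrix.trace_smul, hP.trace_mul, smul_eq_mul, mul_comm]
    | zero => simp
    | add x y _ _ hx hy => rw [Matrix.mul_add, Matrix.trace_add, hx, hy, add_zero]
    | smul c x _ hx => rw [Matrix.mul_smul, Matrix.trace_smul, hx, smul_zero]
  have h2 : Z = 0 := by
    apply Matrix.trace_mul_conjTranspose_self_eq_zero_iff.1 (h1 _)
  exact funext (Fintype.linearIndependent_iff.1 hP.linearIndependent x h2)

/-- Connectedness makes b constant, equal to t/d. As each row of overlaps sums to d, the constant
vector t/d² solves the Gram system, and nondegeneracy makes it the only solution. -/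
theorem eq_div_sq_of_sum_overlap_mul (hP : IsBICPOVM d P) (hd : d ≠ 0) {b x : Fin (d ^ 2) → ℂ}
    {t : ℂ}
    (hb : ∀ j k, (overlap P j k : ℂ) * (b j - b k) = 0)
    (hbx : ∀ k, b k = ∑ j, (overlap P j k : ℂ) * x j)
    (ht : ∑ k, b k = d * t) (j : Fin (d ^ 2)) : x j = 1 / (d : ℂ) ^ 2 * t := by
  have hd' : (d : ℂ) ≠ 0 := by exact_mod_cast hd
  have hconst := hP.eq_of_overlap_mul_sub_eq_zero hb
  have hbk : ∀ k, b k = t / d := fun k => by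
    rw [Finset.sum_congr rfl fun l _ => hconst l k, Finset.sum_const, Finset.card_univ,
      Fintype.card_fin, nsmul_eq_mul] at ht
    push_cast at ht
    field_simp
    exact mul_left_cancel₀ hd' (by rw [← ht]; ring)
  have h0 : (fun j => x j - 1 / (d : ℂ) ^ 2 * t) = 0 := by
    refine hP.eq_zero_of_sum_overlap_mul fun k => ?_
    have hs : ∑ j, (overlap P j k : ℂ) = d := by
      have := hP.sum_overlap k
      simp only [overlap_comm k] at this
      exact_mod_cast congrArg (fun r : ℝ => (r : ℂ)) this
    simp only [mul_sub, Finset.sum_sub_distrib, ← hbx, ← Finset.sum_mul, hs, hbk]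
    field_simp
    ring
  exact sub_eq_zero.1 (congrFun h0 j)

end IsBICPOVM

/-- For idempotents with `(p - q)³ = (1 - s)(p - q)`, the element `pqp - sp` is a multiple of an
idempotent. -/
theorem sandwich_sub_mul_self {R : Type} [Ring R] [Algebra ℂ R] {p q : R} {s : ℂ} (hp : p * p = p)
    (hq : q * q = q) (h : (p - q) * (p - q) * (p - q) = (1 - s) • (p - q)) :
    (p * q * p - s • p) * (p * q * p - s • p) = (1 - s) • (p * q * p - s • p) := by
  have hpx : ∀ x, p * (p * x) = p * x := fun x => by rw [← mul_assoc, hp]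
  have hqx : ∀ x, q * (q * x) = q * x := fun x => by rw [← mul_assoc, hq]
  -- Expanding the cube gives pqp - qpq = s(p - q). Multiplication by p from the left and then from
  -- the right expresses pqpqp through pqp and p.
  have h1 : p * (q * p) - q * (p * q) = s • (p - q) := by
    have h2 : (p - q) * (p - q) * (p - q) = p - q - p * (q * p) + q * (p * q) := by
      simp only [sub_mul, mul_sub, mul_assoc, hp, hq]
      abel
    rw [h2, sub_smul, one_smul] at h
    rw [← sub_eq_zero] at h ⊢
    rw [← neg_eq_zero, ← h]
    abel
  have hTq : p * (q * (p * q)) = p * (q * p) - s • p + s • (p * q) := by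
    have := congrArg (fun x => p * x) h1
    simp only [mul_sub, mul_smul_comm, hp, hpx] at this
    rw [sub_eq_iff_eq_add] at this
    rw [this, smul_sub]; abel
  have hTqp : p * (q * (p * (q * p))) = p * (q * p) - s • p + s • (p * (q * p)) := by
    have := congrArg (fun x => x * p) hTq
    simpa only [sub_mul, add_mul, smul_mul_assoc, mul_assoc, hp] using this
  simp only [sub_mul, mul_sub, mul_assoc, smul_mul_assoc, mul_smul_comm, hp, hpx, hTqp]
  module

/-- The relations which an optimal strategy satisfies on the state, whose purification is the
matrix `Ψ`: the operators `b j` belong to Bob and the operators `a j` to Alice. -/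
structure BellRelations {n E ι : Type} [Fintype n] [Fintype ι] (s : ι → ι → ℝ) (D : ℝ)
    (a b : ι → Matrix n n ℂ) (Ψ : Matrix n E ℂ) : Prop where
  left_isHermitian : ∀ j, (a j).IsHermitian
  right_isHermitian : ∀ j, (b j).IsHermitian
  commute : ∀ j k, Commute (a j) (b k)
  transfer : ∀ j, b j * Ψ = a j * Ψ
  idempotent : ∀ j, b j * b j * Ψ = b j * Ψ
  sum_eq : (∑ j, b j) * Ψ = (D : ℂ) • Ψ
  cubic : ∀ j k, j ≠ k → (b j - b k) * (b j - b k) * (b j - b k) * Ψ =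
    (1 - s j k : ℂ) • ((b j - b k) * Ψ)

/-! ### Rigidity: from the relations on the state to the uniform outcome -/

section Rigidity

variable {n E ι : Type} [Fintype n]

/-- The matrices annihilated by all `X` that commute with the `a j` and annihilate `Ψ`. -/
def supportModule (a : ι → Matrix n n ℂ) (Ψ : Matrix n E ℂ) : Submodule ℂ (Matrix n E ℂ) where
  carrier := {Φ | ∀ X, (∀ j, Commute (a j) X) → X * Ψ = 0 → X * Φ = 0}
  add_mem' h h' X hX hX' := by rw [Matrix.mul_add, h X hX hX', h' X hX hX', add_zero]
  zero_mem' X _ _ := Matrix.mul_zero X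
  smul_mem' c _ h X hX hX' := by rw [Matrix.mul_smul, h X hX hX', smul_zero]

/-- Identities between operators commuting with the a_j, known only on Ψ, extend to the whole
module. So the relations become identities in an endomorphism ring and can be multiplied from either
side. -/
theorem mul_eq_of_mem_supportModule {a : ι → Matrix n n ℂ} {Ψ Φ : Matrix n E ℂ}
    (hΦ : Φ ∈ supportModule a Ψ) {X X' : Matrix n n ℂ} (hX : ∀ j, Commute (a j) X)
    (hX' : ∀ j, Commute (a j) X') (hXX : X * Ψ = X' * Ψ) : X * Φ = X' * Φ := by
  have := hΦ (X - X') (fun j => (hX j).sub_right (hX' j)) (by rw [Matrix.sub_mul, hXX, sub_self])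
  rwa [Matrix.sub_mul, sub_eq_zero] at this

theorem self_mem_supportModule (a : ι → Matrix n n ℂ) (Ψ : Matrix n E ℂ) :
    Ψ ∈ supportModule a Ψ := fun _ _ hX => hX

namespace BellRelations

variable [Fintype ι] {s : ι → ι → ℝ} {D : ℝ} {a b : ι → Matrix n n ℂ} {Ψ : Matrix n E ℂ}

/-- If X commutes with a_k and kills Ψ, then X b_k Ψ = X a_k Ψ = a_k X Ψ = 0. -/
theorem mul_mem_supportModule (h : BellRelations s D a b Ψ) (k : ι) {Φ : Matrix n E ℂ}
    (hΦ : Φ ∈ supportModule a Ψ) :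
    b k * Φ ∈ supportModule a Ψ := by
  intro X hX hX'
  rw [← Matrix.mul_assoc]
  refine hΦ (X * b k) (fun j => (hX j).mul_right (h.commute j k)) ?_
  rw [Matrix.mul_assoc, h.transfer, ← Matrix.mul_assoc, ← (hX k).eq, Matrix.mul_assoc, hX',
    Matrix.mul_zero]

/-- The action of `b k` on the support module. -/
def action (h : BellRelations s D a b Ψ) (k : ι) : Module.End ℂ (supportModule a Ψ) where
  toFun Φ := ⟨b k * Φ.1, h.mul_mem_supportModule k Φ.2⟩
  map_add' _ _ := Subtype.ext (Matrix.mul_add _ _ _)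
  map_smul' _ _ := Subtype.ext (Matrix.mul_smul _ _ _)

theorem action_apply (h : BellRelations s D a b Ψ) (k : ι) (Φ : supportModule a Ψ) :
    (h.action k Φ : Matrix n E ℂ) = b k * Φ.1 :=
  rfl

theorem action_mul_self (h : BellRelations s D a b Ψ) (j : ι) :
    h.action j * h.action j = h.action j := by
  ext1 Φ
  refine Subtype.ext ?_
  have := mul_eq_of_mem_supportModule Φ.2 (fun i => (h.commute i j).mul_right (h.commute i j))
    (fun i => h.commute i j) (h.idempotent j)
  rwa [Matrix.mul_assoc] at this

theorem sum_action (h : BellRelations s D a b Ψ) : ∑ j, h.action j = (D : ℂ) • 1 := by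
  classical
  ext1 Φ
  refine Subtype.ext ?_
  have hc : ∀ i, Commute (a i) (∑ j, b j) := fun i =>
    Finset.sum_induction _ (Commute (a i)) (fun _ _ => Commute.add_right) (Commute.zero_right _)
      fun j _ => h.commute i j
  have := mul_eq_of_mem_supportModule Φ.2 hc (X' := (D : ℂ) • (1 : Matrix n n ℂ))
    (fun i => (Commute.one_right _).smul_right _) (by rw [h.sum_eq]; simp)
  rw [Matrix.sum_mul] at this
  simpa [LinearMap.sum_apply, Submodule.coe_sum, action_apply] using this

theorem action_cubic (h : BellRelations s D a b Ψ) {j k : ι} (hjk : j ≠ k) :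
    (h.action j - h.action k) * (h.action j - h.action k) * (h.action j - h.action k) =
      (1 - s j k : ℂ) • (h.action j - h.action k) := by
  ext1 Φ
  refine Subtype.ext ?_
  have hc : ∀ i, Commute (a i) (b j - b k) := fun i => (h.commute i j).sub_right (h.commute i k)
  have := mul_eq_of_mem_supportModule Φ.2 (fun i => ((hc i).mul_right (hc i)).mul_right (hc i))
    (X' := (1 - s j k : ℂ) • (b j - b k)) (fun i => (hc i).smul_right _)
    (by rw [h.cubic j k hjk, Matrix.smul_mul])
  simp only [Matrix.mul_assoc, Matrix.smul_mul] at this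
  rw [Matrix.sub_mul _ _ (_ * _), Matrix.sub_mul _ _ (_ * _)] at this
  simp only [Matrix.sub_mul] at this
  simpa [action_apply, Matrix.mul_sub] using this

/-- The elements T_k = b_j b_k b_j - s_jk b_j have nonnegative expectation because T_k² = (1 - s_jk)
T_k. Both ∑_k b_k and ∑_k s_jk equal D, so the T_k sum to zero and every one of them vanishes. -/
theorem mul_mul_self_of_mem (h : BellRelations s D a b Ψ) (hs1 : ∀ j, s j j = 1)
    (hs : ∀ j k, j ≠ k → s j k < 1)
    (hsum : ∀ j, ∑ k, s j k = D) (j k : ι) {Φ : Matrix n E ℂ} [Fintype E]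
    (hΦ : Φ ∈ supportModule a Ψ) : b j * (b k * (b j * Φ)) = (s j k : ℂ) • (b j * Φ) := by
  set t : ι → Matrix n n ℂ := fun k => b j * b k * b j - (s j k : ℂ) • b j with ht
  set T : ι → Module.End ℂ (supportModule a Ψ) := fun k =>
    h.action j * h.action k * h.action j - (s j k : ℂ) • h.action j with hT
  have htT : ∀ k (Φ : supportModule a Ψ), (T k Φ : Matrix n E ℂ) = t k * Φ.1 := by
    intro k Φ
    simp [hT, ht, action_apply, Matrix.sub_mul, Matrix.mul_assoc]
  have htH : ∀ k, (t k).IsHermitian := fun k => by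
    simp only [ht, Matrix.IsHermitian, Matrix.conjTranspose_sub, Matrix.conjTranspose_mul,
      (h.right_isHermitian _).eq, Matrix.conjTranspose_smul, Matrix.mul_assoc]
    simp
  have hTself : T j = 0 := by
    simp only [hT, h.action_mul_self, hs1, Complex.ofReal_one, one_smul]
    exact sub_self (h.action j)
  have hTT : ∀ k, T k * T k = (1 - s j k : ℂ) • T k := by
    intro k
    by_cases hjk : j = k
    · subst hjk
      rw [hTself, mul_zero, smul_zero]
    · exact sandwich_sub_mul_self (R := Module.End ℂ (supportModule a Ψ)) (h.action_mul_self j)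
        (h.action_mul_self k) (h.action_cubic hjk)
  have hTsum : ∑ k, T k = 0 := by
    have h1 : ∑ k, h.action j * h.action k * h.action j = (D : ℂ) • h.action j := by
      rw [← Finset.sum_mul, ← Finset.mul_sum, h.sum_action, mul_smul_comm, mul_one, smul_mul_assoc,
        h.action_mul_self]
    have h2 : ∑ k, (s j k : ℂ) • h.action j = (D : ℂ) • h.action j := by
      rw [← Finset.sum_smul, ← Complex.ofReal_sum, hsum]
    refine (Finset.sum_sub_distrib (fun k => h.action j * h.action k * h.action j)
      (fun k => (s j k : ℂ) • h.action j)).trans ?_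
    rw [h1, h2]
    exact sub_self ((D : ℂ) • h.action j)
  have hsq : ∀ k, (t k * t k * (Φ * Φ.conjTranspose)).trace.re =
      (1 - s j k) * (t k * (Φ * Φ.conjTranspose)).trace.re := by
    intro k
    have h1 := congrArg (fun f => (f ⟨Φ, hΦ⟩ : Matrix n E ℂ)) (hTT k)
    simp only [Module.End.mul_apply, LinearMap.smul_apply, Submodule.coe_smul, htT] at h1
    have h2 : t k * t k * (Φ * Φ.conjTranspose) = (t k * (t k * Φ)) * Φ.conjTranspose := by
      simp only [Matrix.mul_assoc]
    rw [h2, h1, Matrix.smul_mul, Matrix.trace_smul, Matrix.mul_assoc, ← Complex.ofReal_one,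
      ← Complex.ofReal_sub, smul_eq_mul, Complex.re_ofReal_mul]
  have hself : ∀ k, j = k → t k * Φ = 0 := by
    rintro k rfl
    rw [← htT j ⟨Φ, hΦ⟩, hTself]; rfl
  -- For k ≠ j divide the expectation of the square by 1 - s_jk > 0; for k = j the element is zero
  -- outright.
  have hnn : ∀ k, 0 ≤ (t k * (Φ * Φ.conjTranspose)).trace.re := by
    intro k
    by_cases hjk : j = k
    · rw [← Matrix.mul_assoc, hself k hjk]; simp
    · have h1 := trace_mul_re_nonneg (posSemidef_mul_self (htH k)) Φ
      rw [hsq] at h1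
      exact nonneg_of_mul_nonneg_right h1 (by linarith [hs j k hjk])
  have hzero : ∑ k, (t k * (Φ * Φ.conjTranspose)).trace.re = 0 := by
    have h1 := congrArg (fun f => (f ⟨Φ, hΦ⟩ : Matrix n E ℂ)) hTsum
    simp only [LinearMap.sum_apply, Submodule.coe_sum, htT, LinearMap.zero_apply,
      Submodule.coe_zero] at h1
    rw [← Complex.re_sum, ← Matrix.trace_sum]
    simp only [← Matrix.mul_assoc]
    rw [← Matrix.sum_mul, h1]; simp
  have hk := (Finset.sum_eq_zero_iff_of_nonneg fun k _ => hnn k).1 hzero k (Finset.mem_univ k)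
  have h0 : t k * Φ = 0 := by
    refine mul_eq_zero_of_mul_self_mul (htH k)
      (mul_eq_zero_of_trace_re_eq_zero (posSemidef_mul_self (htH k)) ?_)
    rw [hsq, hk, mul_zero]
  rw [ht, Matrix.sub_mul, sub_eq_zero, Matrix.smul_mul] at h0
  simpa only [Matrix.mul_assoc] using h0

/-- The state is tracial on the algebra generated by Bob's operators. -/
theorem conjTranspose_mul_mul_comm (h : BellRelations s D a b Ψ) (k : ι) {X : Matrix n n ℂ}
    (hX : Commute (a k) X) :
    Ψ.conjTranspose * (X * (b k * Ψ)) = Ψ.conjTranspose * (b k * (X * Ψ)) := by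
  have h1 : Ψ.conjTranspose * b k = Ψ.conjTranspose * a k := by
    have := congrArg Matrix.conjTranspose (h.transfer k)
    rwa [Matrix.conjTranspose_mul, Matrix.conjTranspose_mul, (h.right_isHermitian k).eq,
      (h.left_isHermitian k).eq] at this
  -- Replace b_k by a_k on Ψ, move a_k past X to the left, and turn it back into b_k on Ψ*.
  rw [h.transfer, ← Matrix.mul_assoc X, ← hX.eq, ← Matrix.mul_assoc, ← Matrix.mul_assoc, ← h1]
  simp only [Matrix.mul_assoc]

/-- Double b_j by idempotence, move one copy cyclically to the right end, and apply b_j b_k b_j =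
s_jk b_j. -/
theorem overlap_smul_eq (h : BellRelations s D a b Ψ) [Fintype E] (hs1 : ∀ j, s j j = 1)
    (hs : ∀ j k, j ≠ k → s j k < 1)
    (hsum : ∀ j, ∑ k, s j k = D) (j k : ι) :
    Ψ.conjTranspose * (b j * (b k * Ψ)) = (s j k : ℂ) • (Ψ.conjTranspose * (b j * Ψ)) := by
  have h1 : b j * (b j * (b k * Ψ)) = b j * (b k * Ψ) := by
    have := congrArg (fun f => (f (h.action k ⟨Ψ, self_mem_supportModule a Ψ⟩) : Matrix n E ℂ))
      (h.action_mul_self j)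
    exact this
  have h2 := h.conjTranspose_mul_mul_comm j ((h.commute j j).mul_right (h.commute j k))
  simp only [Matrix.mul_assoc] at h2
  rw [← h1, ← h2, h.mul_mul_self_of_mem hs1 hs hsum j k (self_mem_supportModule a Ψ),
    Matrix.mul_smul]

/-- Since M_j absorbs b_j on Ψ and on Ψ*, and commutes with Bob's operators, a factor b_j can be
inserted on both sides of b_k; then b_j b_k b_j = s_jk b_j applies. -/
theorem compress_mul (h : BellRelations s D a b Ψ) [Fintype E] (hs1 : ∀ j, s j j = 1)
    (hs : ∀ j k, j ≠ k → s j k < 1)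
    (hsum : ∀ j, ∑ k, s j k = D) {M : ι → Matrix n n ℂ} (hM : ∀ j, (M j).IsHermitian)
    (hMb : ∀ j k, Commute (M j) (b k)) (hM' : ∀ j, M j * (b j * Ψ) = M j * Ψ) (j k : ι) :
    Ψ.conjTranspose * (M j * (b k * Ψ)) = (s j k : ℂ) • (Ψ.conjTranspose * (M j * Ψ)) := by
  have h1 : Ψ.conjTranspose * (b j * M j) = Ψ.conjTranspose * M j := by
    have := congrArg Matrix.conjTranspose (hM' j)
    rwa [Matrix.conjTranspose_mul, Matrix.conjTranspose_mul, Matrix.conjTranspose_mul, (hM j).eq,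
      (h.right_isHermitian j).eq, Matrix.mul_assoc] at this
  have h2 : M j * (b k * Ψ) = M j * (b k * (b j * Ψ)) := by
    rw [← Matrix.mul_assoc, (hMb j k).eq, Matrix.mul_assoc, ← hM' j, ← Matrix.mul_assoc,
      ← (hMb j k).eq, Matrix.mul_assoc]
  rw [h2, ← Matrix.mul_assoc, ← h1, ← (hMb j j).eq, Matrix.mul_assoc, Matrix.mul_assoc,
    h.mul_mul_self_of_mem hs1 hs hsum j k (self_mem_supportModule a Ψ), Matrix.mul_smul, hM',
    Matrix.mul_smul]

end BellRelations

/-- The outcome of the POVM `M` is uniform and uncorrelated with the purifying system. -/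
theorem BellRelations.compress_eq [Fintype E] [DecidableEq n] {d : ℕ} (hd : d ≠ 0)
    {P : Fin (d ^ 2) → Matrix (Fin d) (Fin d) ℂ} (hP : IsBICPOVM d P)
    {a b : Fin (d ^ 2) → Matrix n n ℂ} {Ψ : Matrix n E ℂ}
    (h : BellRelations (overlap P) d a b Ψ) {M : Fin (d ^ 2) → Matrix n n ℂ}
    (hM : ∀ j, (M j).IsHermitian) (hMb : ∀ j k, Commute (M j) (b k))
    (hM' : ∀ j, M j * (b j * Ψ) = M j * Ψ) (hM1 : ∑ j, M j = 1) (j : Fin (d ^ 2)) :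
    Ψ.conjTranspose * M j * Ψ = (1 / (d : ℂ) ^ 2) • (Ψ.conjTranspose * Ψ) := by
  have hs1 := hP.overlap_self
  have hs : ∀ j k, j ≠ k → overlap P j k < 1 := fun j k => hP.overlap_lt_one
  have hsum := hP.sum_overlap
  rw [Matrix.mul_assoc]
  -- The compressions are matrices on E; the scalar linear system is solved entry by entry.
  ext e e'
  rw [Matrix.smul_apply, smul_eq_mul]
  refine hP.eq_div_sq_of_sum_overlap_mul hd
    (b := fun k => (Ψ.conjTranspose * (b k * Ψ)) e e')
    (x := fun k => (Ψ.conjTranspose * (M k * Ψ)) e e') ?_ ?_ ?_ j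
  -- Both s_kl f_k and s_kl f_l equal the compression of b_k b_l, by traciality.
  · intro k l
    have h1 := h.overlap_smul_eq hs1 hs hsum k l
    have h2 := h.overlap_smul_eq hs1 hs hsum l k
    rw [← h.conjTranspose_mul_mul_comm l (h.commute l k), h1, IsBICPOVM.overlap_comm l k] at h2
    have h3 := congrFun (congrFun h2 e) e'
    simp only [Matrix.smul_apply, smul_eq_mul] at h3
    rw [mul_sub, h3, sub_self]
  · intro k
    have h1 : Ψ.conjTranspose * (b k * Ψ) = ∑ j, Ψ.conjTranspose * (M j * (b k * Ψ)) := by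
      rw [← Matrix.mul_sum, ← Matrix.sum_mul, hM1, Matrix.one_mul]
    simp only [h1, Matrix.sum_apply, h.compress_mul hs1 hs hsum hM hMb hM', Matrix.smul_apply,
      smul_eq_mul]
  · have h1 : ∑ k, Ψ.conjTranspose * (b k * Ψ) = (d : ℂ) • (Ψ.conjTranspose * Ψ) := by
      rw [← Matrix.mul_sum, ← Matrix.sum_mul, h.sum_eq, Matrix.mul_smul]; simp
    have h2 := congrFun (congrFun h1 e) e'
    rwa [Matrix.sum_apply] at h2

end Rigidity

/-! ### Expectation values and sums over pairs -/

section Expectation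

variable {n : Type} [Fintype n]

/-- The expectation value `Re tr(M ρ)` as a linear functional of `M`. -/
noncomputable def expectation (ρ : Matrix n n ℂ) : Matrix n n ℂ →ₗ[ℝ] ℝ where
  toFun M := (M * ρ).trace.re
  map_add' M N := by rw [Matrix.add_mul, Matrix.trace_add, Complex.add_re]
  map_smul' c M := by
    rw [Matrix.smul_mul, Matrix.trace_smul, Complex.smul_re, RingHom.id_apply]

theorem expectation_apply (ρ M : Matrix n n ℂ) : expectation ρ M = (M * ρ).trace.re := rfl

theorem expectation_nonneg {E : Type} [Fintype E] {M : Matrix n n ℂ} (hM : M.PosSemidef)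
    (Ψ : Matrix n E ℂ) : 0 ≤ expectation (Ψ * Ψ.conjTranspose) M :=
  trace_mul_re_nonneg hM Ψ

theorem smul_sub_mul_self (c : ℝ) {M N : Matrix n n ℂ} (h : Commute M N) :
    (c • M - N) * (c • M - N) = (c * c) • (M * M) - (2 * c) • (M * N) + N * N := by
  rw [Matrix.sub_mul, Matrix.mul_sub, Matrix.mul_sub, Matrix.smul_mul, Matrix.mul_smul,
    Matrix.smul_mul, Matrix.mul_smul, ← h.eq, smul_smul, two_mul, add_smul]
  abel

end Expectation

theorem two_mul_sum_pairs {N : ℕ} (f : Fin N → Fin N → ℝ) (h0 : ∀ j, f j j = 0)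
    (hf : ∀ j k, f j k = f k j) : 2 * ∑ q : Pairs N, f q.1.1 q.1.2 = ∑ j, ∑ k, f j k := by
  have h1 : ∑ q : Pairs N, f q.1.1 q.1.2 = ∑ j, ∑ k, if j < k then f j k else 0 := by
    rw [← Fintype.sum_prod_type' (f := fun j k : Fin N => if j < k then f j k else 0),
      ← Finset.sum_filter]
    exact (Finset.sum_subtype _ (fun x => by simp) fun x : Fin N × Fin N => f x.1 x.2).symm
  have h2 : ∑ q : Pairs N, f q.1.1 q.1.2 = ∑ j, ∑ k, if k < j then f j k else 0 := by
    rw [h1, Finset.sum_comm]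
    exact Finset.sum_congr rfl fun k _ => Finset.sum_congr rfl fun j _ => by rw [hf]
  rw [two_mul]
  nth_rewrite 1 [h1]
  rw [h2]
  simp only [← Finset.sum_add_distrib]
  refine Finset.sum_congr rfl fun j _ => Finset.sum_congr rfl fun k _ => ?_
  rcases lt_trichotomy j k with h | rfl | h
  · simp [h, h.asymm]
  · simp [h0]
  · simp [h, h.asymm]

/-! ### Three-outcome measurements and their defect from projectivity -/

section ThreeOutcome

variable {n : Type} [Fintype n] [DecidableEq n] {M N : Matrix n n ℂ}

/-- An explicit positivity certificate, valid without projectivity. Its last summand isolates the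
third effect 1 - M - N. -/
theorem add_sub_sub_mul_self_eq (M N : Matrix n n ℂ) :
    M + N - (M - N) * (M - N) = (1 - (M - N)) * M * (1 - (M - N)) +
      (1 + (M - N)) * N * (1 + (M - N)) + (M - N) * (1 - M - N) * (M - N) := by
  noncomm_ring

theorem three_outcome_summands_posSemidef (hM : M.PosSemidef) (hN : N.PosSemidef)
    (hMN : (1 - M - N).PosSemidef) :
    ((1 - (M - N)) * M * (1 - (M - N))).PosSemidef ∧
      ((1 + (M - N)) * N * (1 + (M - N))).PosSemidef ∧
      ((M - N) * (1 - M - N) * (M - N)).PosSemidef := by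
  have hD : (M - N).IsHermitian := hM.isHermitian.sub hN.isHermitian
  have h1 := hM.conjTranspose_mul_mul_same (1 - (M - N))
  have h2 := hN.conjTranspose_mul_mul_same (1 + (M - N))
  have h3 := hMN.conjTranspose_mul_mul_same (M - N)
  rw [(Matrix.isHermitian_one.sub hD).eq] at h1
  rw [(Matrix.isHermitian_one.add hD).eq] at h2
  rw [hD.eq] at h3
  exact ⟨h1, h2, h3⟩

theorem posSemidef_add_sub_sub_mul_self (hM : M.PosSemidef) (hN : N.PosSemidef)
    (hMN : (1 - M - N).PosSemidef) : (M + N - (M - N) * (M - N)).PosSemidef := by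
  obtain ⟨h1, h2, h3⟩ := three_outcome_summands_posSemidef hM hN hMN
  rw [add_sub_sub_mul_self_eq]
  exact (h1.add h2).add h3

/-- All three positive summands of the defect have zero expectation; the last one says that the
third effect kills (M - N)Ψ. -/
theorem third_outcome_mul_eq_zero (hM : M.PosSemidef) (hN : N.PosSemidef)
    (hMN : (1 - M - N).PosSemidef) {E : Type} [Fintype E] {Ψ : Matrix n E ℂ}
    (h : expectation (Ψ * Ψ.conjTranspose) (M + N - (M - N) * (M - N)) = 0) :
    (1 - M - N) * ((M - N) * Ψ) = 0 := by
  obtain ⟨h1, h2, h3⟩ := three_outcome_summands_posSemidef hM hN hMN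
  rw [add_sub_sub_mul_self_eq, map_add, map_add] at h
  have h4 : expectation (Ψ * Ψ.conjTranspose) ((M - N) * (1 - M - N) * (M - N)) = 0 := by
    linarith [expectation_nonneg h1 Ψ, expectation_nonneg h2 Ψ, expectation_nonneg h3 Ψ]
  have h5 := mul_eq_zero_of_trace_re_eq_zero h3 h4
  refine mul_eq_zero_of_conjTranspose_mul_mul hMN ?_
  rw [Matrix.conjTranspose_mul, (hM.isHermitian.sub hN.isHermitian).eq]
  simp only [Matrix.mul_assoc] at h5 ⊢
  rw [h5, Matrix.mul_zero]

end ThreeOutcome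

/-- The operators that enter the Bell function, acting on the joint Hilbert space. -/
structure BellOperators (d : ℕ) (n : Type) [Fintype n] [DecidableEq n] where
  one : Pairs (d ^ 2) → Matrix n n ℂ
  two : Pairs (d ^ 2) → Matrix n n ℂ
  bob : Fin (d ^ 2) → Matrix n n ℂ
  povm : Fin (d ^ 2) → Matrix n n ℂ
  one_posSemidef : ∀ q, (one q).PosSemidef
  two_posSemidef : ∀ q, (two q).PosSemidef
  bot_posSemidef : ∀ q, (1 - one q - two q).PosSemidef
  bob_posSemidef : ∀ j, (bob j).PosSemidef
  bob_compl_posSemidef : ∀ j, (1 - bob j).PosSemidef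
  povm_isHermitian : ∀ j, (povm j).IsHermitian
  povm_mul_posSemidef : ∀ j, (povm j * (1 - bob j)).PosSemidef
  povm_sum : ∑ j, povm j = 1
  commute_one : ∀ q j, Commute (one q) (bob j)
  commute_two : ∀ q j, Commute (two q) (bob j)
  commute_povm : ∀ j k, Commute (povm j) (bob k)

/-! ### Sum of squares for the Bell function and the case of equality -/

namespace BellOperators

variable {d : ℕ} {n : Type} [Fintype n] [DecidableEq n] (T : BellOperators d n)
  (s : Fin (d ^ 2) → Fin (d ^ 2) → ℝ)

/-- The value of the Bell function in the state `ρ`. -/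
noncomputable def value (ρ : Matrix n n ℂ) : ℝ :=
  2 * ∑ q : Pairs (d ^ 2), √(1 - s q.1.1 q.1.2) *
      (expectation ρ (T.one q * T.bob q.1.1) + expectation ρ (T.two q * T.bob q.1.2)
        - expectation ρ (T.one q * T.bob q.1.2) - expectation ρ (T.two q * T.bob q.1.1))
    - ∑ q : Pairs (d ^ 2), (1 - s q.1.1 q.1.2) *
      (expectation ρ (T.one q) + expectation ρ (T.two q))
    - (d : ℝ) * ((d : ℝ) - 2) * ∑ j : Fin (d ^ 2), expectation ρ (T.bob j)
    - ∑ j : Fin (d ^ 2), expectation ρ (T.povm j * (1 - T.bob j))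

/-- The deviation of Alice's observable from the difference of Bob's projections. -/
noncomputable def deviation (q : Pairs (d ^ 2)) : Matrix n n ℂ :=
  √(1 - s q.1.1 q.1.2) • (T.one q - T.two q) - (T.bob q.1.1 - T.bob q.1.2)

/-- The defect of Alice's measurement `q` from being projective. -/
def defect (q : Pairs (d ^ 2)) : Matrix n n ℂ :=
  T.one q + T.two q - (T.one q - T.two q) * (T.one q - T.two q)

theorem deviation_isHermitian (q : Pairs (d ^ 2)) : (T.deviation s q).IsHermitian := by
  have h1 := ((T.one_posSemidef q).isHermitian.sub (T.two_posSemidef q).isHermitian)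
  have h2 := ((T.bob_posSemidef q.1.1).isHermitian.sub (T.bob_posSemidef q.1.2).isHermitian)
  refine Matrix.IsHermitian.sub ?_ h2
  rw [Matrix.IsHermitian, Matrix.conjTranspose_smul, h1.eq]
  simp

theorem commute_diff (q : Pairs (d ^ 2)) (j : Fin (d ^ 2)) :
    Commute (T.one q - T.two q) (T.bob j) :=
  (T.commute_one q j).sub_left (T.commute_two q j)

theorem deviation_mul_self (q : Pairs (d ^ 2)) (hs : s q.1.1 q.1.2 ≤ 1) :
    T.deviation s q * T.deviation s q =
      (1 - s q.1.1 q.1.2) • ((T.one q - T.two q) * (T.one q - T.two q)) -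
      (2 * √(1 - s q.1.1 q.1.2)) • ((T.one q - T.two q) * (T.bob q.1.1 - T.bob q.1.2)) +
      (T.bob q.1.1 - T.bob q.1.2) * (T.bob q.1.1 - T.bob q.1.2) := by
  rw [deviation, smul_sub_mul_self _ ((T.commute_diff q q.1.1).sub_right (T.commute_diff q q.1.2)),
    Real.mul_self_sqrt (by linarith)]

/-- The sum of squares decomposition of the Bell function. -/
theorem sq_sub_value {ρ : Matrix n n ℂ} (hρ : expectation ρ 1 = 1) (hs : ∀ j k, s j k ≤ 1) :
    (d : ℝ) ^ 2 - T.value s ρ =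
      ∑ q, (expectation ρ (T.deviation s q * T.deviation s q) +
        (1 - s q.1.1 q.1.2) * expectation ρ (T.defect q)) +
      (d : ℝ) ^ 2 * ∑ j, expectation ρ (T.bob j - T.bob j * T.bob j) +
      expectation ρ (((d : ℝ) • 1 - ∑ j, T.bob j) * ((d : ℝ) • 1 - ∑ j, T.bob j)) +
      ∑ j, expectation ρ (T.povm j * (1 - T.bob j)) := by
  -- There are d² indices, so ∑_{j<k} (b_j - b_k)² = d² ∑ b_j² - (∑ b_j)². The last term cancels
  -- against the square of d - ∑ b_j, and the remaining linear terms have coefficient d² - 2d = d(d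
  -- - 2).
  have hY : ∑ q : Pairs (d ^ 2),
      expectation ρ ((T.bob q.1.1 - T.bob q.1.2) * (T.bob q.1.1 - T.bob q.1.2)) =
      (d : ℝ) ^ 2 * ∑ j, expectation ρ (T.bob j * T.bob j) -
        expectation ρ ((∑ j, T.bob j) * ∑ j, T.bob j) := by
    have h1 := two_mul_sum_pairs
      (fun j k => expectation ρ ((T.bob j - T.bob k) * (T.bob j - T.bob k))) (fun j => by simp)
      (fun j k => by rw [← neg_sub (T.bob k), neg_mul_neg])
    have h2 : ∀ j k, expectation ρ ((T.bob j - T.bob k) * (T.bob j - T.bob k)) =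
        expectation ρ (T.bob j * T.bob j) + expectation ρ (T.bob k * T.bob k) -
          expectation ρ (T.bob j * T.bob k) - expectation ρ (T.bob k * T.bob j) := by
      intro j k
      rw [← map_add, ← map_sub, ← map_sub]
      congr 1
      noncomm_ring
    have h3 : ∑ j, ∑ k, expectation ρ (T.bob j * T.bob k) =
        expectation ρ ((∑ j, T.bob j) * ∑ j, T.bob j) := by
      rw [Finset.sum_mul, map_sum]
      simp only [Finset.mul_sum, map_sum]
    have h4 : ∑ j, ∑ k, expectation ρ (T.bob k * T.bob j) =
        expectation ρ ((∑ j, T.bob j) * ∑ j, T.bob j) := by rw [Finset.sum_comm, h3]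
    simp only [h2, Finset.sum_sub_distrib, Finset.sum_add_distrib, h3, h4, Finset.sum_const,
      Finset.card_univ, Fintype.card_fin, nsmul_eq_mul, ← Finset.mul_sum] at h1
    push_cast at h1
    simp only [h2, Finset.sum_sub_distrib, Finset.sum_add_distrib]
    linarith
  have hq : ∀ q : Pairs (d ^ 2), expectation ρ (T.deviation s q * T.deviation s q) +
      (1 - s q.1.1 q.1.2) * expectation ρ (T.defect q) =
      expectation ρ ((T.bob q.1.1 - T.bob q.1.2) * (T.bob q.1.1 - T.bob q.1.2)) -
      2 * (√(1 - s q.1.1 q.1.2) *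
      (expectation ρ (T.one q * T.bob q.1.1) + expectation ρ (T.two q * T.bob q.1.2)
        - expectation ρ (T.one q * T.bob q.1.2) - expectation ρ (T.two q * T.bob q.1.1))) +
      (1 - s q.1.1 q.1.2) * (expectation ρ (T.one q) + expectation ρ (T.two q)) := by
    intro q
    have h1 : (T.one q - T.two q) * (T.bob q.1.1 - T.bob q.1.2) = T.one q * T.bob q.1.1 +
        T.two q * T.bob q.1.2 - T.one q * T.bob q.1.2 - T.two q * T.bob q.1.1 := by
      noncomm_ring
    rw [T.deviation_mul_self s q (hs _ _), defect, h1]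
    simp only [map_add, map_sub, map_smul, smul_eq_mul]
    ring
  have hD : expectation ρ (((d : ℝ) • 1 - ∑ j, T.bob j) * ((d : ℝ) • 1 - ∑ j, T.bob j)) =
      (d : ℝ) ^ 2 - 2 * d * ∑ j, expectation ρ (T.bob j) +
        expectation ρ ((∑ j, T.bob j) * ∑ j, T.bob j) := by
    rw [smul_sub_mul_self _ (Commute.one_left _), map_add, map_sub, map_smul, map_smul,
      Matrix.one_mul, Matrix.one_mul, hρ, map_sum]
    simp [sq]
  rw [Finset.sum_congr rfl fun q _ => hq q, Finset.sum_add_distrib, Finset.sum_sub_distrib, hY, hD,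
    value, ← Finset.mul_sum]
  simp only [map_sub, Finset.sum_sub_distrib]
  ring

section Optimal

variable {s} {E : Type} [Fintype E] {Ψ : Matrix n E ℂ}

theorem defect_posSemidef (q : Pairs (d ^ 2)) : (T.defect q).PosSemidef :=
  posSemidef_add_sub_sub_mul_self (T.one_posSemidef q) (T.two_posSemidef q) (T.bot_posSemidef q)

theorem bob_sub_mul_self_posSemidef (j : Fin (d ^ 2)) : (T.bob j - T.bob j * T.bob j).PosSemidef :=
  posSemidef_sub_mul_self (T.bob_posSemidef j) (T.bob_compl_posSemidef j)

theorem smul_one_sub_sum_isHermitian :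
    ((d : ℝ) • (1 : Matrix n n ℂ) - ∑ j, T.bob j).IsHermitian := by
  rw [Matrix.IsHermitian, Matrix.conjTranspose_sub, Matrix.conjTranspose_sum,
    Matrix.conjTranspose_smul, Matrix.conjTranspose_one]
  simp [(T.bob_posSemidef _).isHermitian.eq]

theorem pair_summand_nonneg (hs : ∀ j k, s j k ≤ 1) (q : Pairs (d ^ 2)) :
    0 ≤ expectation (Ψ * Ψ.conjTranspose) (T.deviation s q * T.deviation s q) +
        (1 - s q.1.1 q.1.2) * expectation (Ψ * Ψ.conjTranspose) (T.defect q) :=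
  add_nonneg (expectation_nonneg (posSemidef_mul_self (T.deviation_isHermitian s q)) Ψ)
    (mul_nonneg (by linarith [hs q.1.1 q.1.2]) (expectation_nonneg (T.defect_posSemidef q) Ψ))

theorem value_le (hΨ : expectation (Ψ * Ψ.conjTranspose) 1 = 1) (hs : ∀ j k, s j k ≤ 1) :
    T.value s (Ψ * Ψ.conjTranspose) ≤ (d : ℝ) ^ 2 := by
  have h := T.sq_sub_value s hΨ hs
  have h1 := Finset.sum_nonneg fun q (_ : q ∈ Finset.univ) => T.pair_summand_nonneg (Ψ := Ψ) hs q
  have h2 := Finset.sum_nonneg fun j (_ : j ∈ Finset.univ) =>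
    expectation_nonneg (T.bob_sub_mul_self_posSemidef j) Ψ
  have h3 := expectation_nonneg (posSemidef_mul_self T.smul_one_sub_sum_isHermitian) Ψ
  have h4 := Finset.sum_nonneg fun j (_ : j ∈ Finset.univ) =>
    expectation_nonneg (T.povm_mul_posSemidef j) Ψ
  have h5 := mul_nonneg (sq_nonneg (d : ℝ)) h2
  linarith

/-- The consequences of optimality, summand by summand. -/
theorem eq_zero_of_value_eq (hd : d ≠ 0) (hΨ : expectation (Ψ * Ψ.conjTranspose) 1 = 1)
    (hs : ∀ j k, s j k ≤ 1)
    (hval : T.value s (Ψ * Ψ.conjTranspose) = (d : ℝ) ^ 2) :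
    (∀ q, T.deviation s q * Ψ = 0) ∧
    (∀ q : Pairs (d ^ 2), s q.1.1 q.1.2 < 1 →
      expectation (Ψ * Ψ.conjTranspose) (T.defect q) = 0) ∧
    (∀ j, T.bob j * T.bob j * Ψ = T.bob j * Ψ) ∧
    (∑ j, T.bob j) * Ψ = (d : ℝ) • Ψ ∧ ∀ j, T.povm j * (T.bob j * Ψ) = T.povm j * Ψ := by
  have h := T.sq_sub_value s hΨ hs
  have hpos : (0 : ℝ) < (d : ℝ) ^ 2 := by positivity
  have h1' := fun q (_ : q ∈ Finset.univ) => T.pair_summand_nonneg (Ψ := Ψ) hs q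
  have h2' := fun j (_ : j ∈ Finset.univ) => expectation_nonneg (T.bob_sub_mul_self_posSemidef j) Ψ
  have h4' := fun j (_ : j ∈ Finset.univ) => expectation_nonneg (T.povm_mul_posSemidef j) Ψ
  have h1 := Finset.sum_nonneg h1'
  have h2 := Finset.sum_nonneg h2'
  have h3 := expectation_nonneg (posSemidef_mul_self T.smul_one_sub_sum_isHermitian) Ψ
  have h4 := Finset.sum_nonneg h4'
  have h5 := mul_nonneg hpos.le h2
  have e1 := (Finset.sum_eq_zero_iff_of_nonneg h1').1 (by linarith)
  have e2 := (Finset.sum_eq_zero_iff_of_nonneg h2').1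
    ((mul_eq_zero.1 (by linarith : (d : ℝ) ^ 2 * _ = 0)).resolve_left hpos.ne')
  have e3 : expectation (Ψ * Ψ.conjTranspose)
    (((d : ℝ) • 1 - ∑ j, T.bob j) * ((d : ℝ) • 1 - ∑ j, T.bob j)) = 0 := by linarith
  have e4 := (Finset.sum_eq_zero_iff_of_nonneg h4').1 (by linarith)
  have f1 := fun q => expectation_nonneg (posSemidef_mul_self (T.deviation_isHermitian s q)) Ψ
  have f2 := fun q => expectation_nonneg (T.defect_posSemidef q) Ψ
  have f3 : ∀ q : Pairs (d ^ 2),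
      0 ≤ (1 - s q.1.1 q.1.2) * expectation (Ψ * Ψ.conjTranspose) (T.defect q) := fun q =>
    mul_nonneg (by linarith [hs q.1.1 q.1.2]) (f2 q)
  refine ⟨fun q => ?_, fun q hq => ?_, fun j => ?_, ?_, fun j => ?_⟩
  · refine mul_eq_zero_of_mul_self_mul (T.deviation_isHermitian s q)
      (mul_eq_zero_of_trace_re_eq_zero (posSemidef_mul_self (T.deviation_isHermitian s q)) ?_)
    have := e1 q (Finset.mem_univ q)
    rw [← expectation_apply]
    linarith [f1 q, f3 q]
  · have := e1 q (Finset.mem_univ q)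
    have h0 : (1 - s q.1.1 q.1.2) * expectation (Ψ * Ψ.conjTranspose) (T.defect q) = 0 := by
      linarith [f1 q, f3 q]
    exact (mul_eq_zero.1 h0).resolve_left (by linarith)
  · have := mul_eq_zero_of_trace_re_eq_zero (T.bob_sub_mul_self_posSemidef j)
      (e2 j (Finset.mem_univ j))
    rw [Matrix.sub_mul, sub_eq_zero] at this
    exact this.symm
  · have := mul_eq_zero_of_mul_self_mul T.smul_one_sub_sum_isHermitian
      (mul_eq_zero_of_trace_re_eq_zero (posSemidef_mul_self T.smul_one_sub_sum_isHermitian) e3)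
    rw [Matrix.sub_mul, sub_eq_zero, Matrix.smul_mul, Matrix.one_mul] at this
    exact this.symm
  · have := mul_eq_zero_of_trace_re_eq_zero (T.povm_mul_posSemidef j) (e4 j (Finset.mem_univ j))
    rw [Matrix.mul_sub, Matrix.mul_one, Matrix.sub_mul, sub_eq_zero, Matrix.mul_assoc] at this
    exact this.symm

end Optimal

end BellOperators

/-! ### Alice's mirror operators and the cubic relation -/

namespace BellOperators

variable {d : ℕ} {n : Type} [Fintype n] [DecidableEq n] (T : BellOperators d n)
  (s : Fin (d ^ 2) → Fin (d ^ 2) → ℝ)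

/-- Alice's operator that acts on an optimal state as `bob j - bob k`. -/
noncomputable def pairOperator (j k : Fin (d ^ 2)) : Matrix n n ℂ :=
  if h : j < k then √(1 - s j k) • (T.one ⟨(j, k), h⟩ - T.two ⟨(j, k), h⟩)
  else if h : k < j then -(√(1 - s k j) • (T.one ⟨(k, j), h⟩ - T.two ⟨(k, j), h⟩)) else 0

/-- Alice's operator that acts on an optimal state as `bob j`. -/
noncomputable def mirror (j : Fin (d ^ 2)) : Matrix n n ℂ :=
  (1 / (d : ℝ) ^ 2) • (∑ k, T.pairOperator s j k + (d : ℝ) • 1)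

theorem diff_isHermitian (q : Pairs (d ^ 2)) : (T.one q - T.two q).IsHermitian :=
  (T.one_posSemidef q).isHermitian.sub (T.two_posSemidef q).isHermitian

theorem isHermitian_real_smul {n : Type} (c : ℝ) {M : Matrix n n ℂ} (hM : M.IsHermitian) :
    (c • M).IsHermitian := by
  rw [Matrix.IsHermitian, Matrix.conjTranspose_smul, hM.eq]; simp

theorem pairOperator_isHermitian (j k : Fin (d ^ 2)) : (T.pairOperator s j k).IsHermitian := by
  unfold pairOperator
  split_ifs
  · exact isHermitian_real_smul _ (T.diff_isHermitian _)
  · exact (isHermitian_real_smul _ (T.diff_isHermitian _)).neg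
  · exact Matrix.isHermitian_zero

theorem mirror_isHermitian (j : Fin (d ^ 2)) : (T.mirror s j).IsHermitian := by
  refine isHermitian_real_smul _ (Matrix.IsHermitian.add ?_
    (isHermitian_real_smul _ Matrix.isHermitian_one))
  rw [Matrix.IsHermitian, Matrix.conjTranspose_sum]
  exact Finset.sum_congr rfl fun k _ => T.pairOperator_isHermitian s j k

theorem commute_pairOperator (j k l : Fin (d ^ 2)) :
    Commute (T.pairOperator s j k) (T.bob l) := by
  unfold pairOperator
  split_ifs
  · exact (T.commute_diff _ l).smul_left _
  · exact ((T.commute_diff _ l).smul_left _).neg_left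
  · exact Commute.zero_left _

theorem commute_mirror (j l : Fin (d ^ 2)) : Commute (T.mirror s j) (T.bob l) := by
  refine Commute.smul_left (Commute.add_left ?_ ((Commute.one_left _).smul_left _)) _
  exact Finset.sum_induction _ (fun X => Commute X (T.bob l)) (fun _ _ => Commute.add_left)
    (Commute.zero_left _) fun k _ => T.commute_pairOperator s j k l

variable {s} {E : Type} {Ψ : Matrix n E ℂ}

theorem smul_diff_mul (hdev : ∀ q, T.deviation s q * Ψ = 0) (q : Pairs (d ^ 2)) :
    √(1 - s q.1.1 q.1.2) • ((T.one q - T.two q) * Ψ) = (T.bob q.1.1 - T.bob q.1.2) * Ψ := by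
  have := hdev q
  rwa [deviation, Matrix.sub_mul, sub_eq_zero, Matrix.smul_mul] at this

theorem pairOperator_mul (hdev : ∀ q, T.deviation s q * Ψ = 0) (j k : Fin (d ^ 2)) :
    T.pairOperator s j k * Ψ = (T.bob j - T.bob k) * Ψ := by
  unfold pairOperator
  split_ifs with h h'
  · rw [Matrix.smul_mul]
    exact T.smul_diff_mul hdev ⟨(j, k), h⟩
  · rw [Matrix.neg_mul, Matrix.smul_mul, T.smul_diff_mul hdev ⟨(k, j), h'⟩, ← Matrix.neg_mul,
      neg_sub]
  · rw [le_antisymm (not_lt.1 h') (not_lt.1 h), sub_self]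

/-- Summing (b_j - b_k)Ψ over all d² values of k gives d² b_j Ψ - d Ψ, so b_j Ψ is expressed through
Alice's operators alone. -/
theorem bob_mul_eq_mirror_mul (hd : d ≠ 0) (hdev : ∀ q, T.deviation s q * Ψ = 0)
    (hsum : (∑ j, T.bob j) * Ψ = (d : ℝ) • Ψ) (j : Fin (d ^ 2)) :
    T.bob j * Ψ = T.mirror s j * Ψ := by
  have hd' : (d : ℝ) ^ 2 ≠ 0 := by positivity
  rw [mirror, Matrix.smul_mul, Matrix.add_mul, Matrix.sum_mul,
    Finset.sum_congr rfl fun k _ => T.pairOperator_mul hdev j k]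
  simp only [Matrix.sub_mul, Finset.sum_sub_distrib, ← Matrix.sum_mul, hsum, Matrix.smul_mul,
    Matrix.one_mul, sub_add_cancel, Finset.sum_const, Finset.card_univ, Fintype.card_fin]
  rw [← Nat.cast_smul_eq_nsmul ℝ, smul_smul]
  push_cast
  rw [one_div, inv_mul_cancel₀ hd', one_smul]

/-- Let D and S be the difference and the sum of Alice's two effects, Y = b_j - b_k and c = √(1 -
s_jk). On Ψ one has cD = Y, S = D² and SD = D. As Y commutes with S and D, c S D Ψ = Y S Ψ = Y D² Ψ
= c D³ Ψ. Hence D³Ψ = DΨ and Y³Ψ = c² YΨ. -/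
theorem cubic_of_pair [Fintype E] (q : Pairs (d ^ 2)) (hs : s q.1.1 q.1.2 < 1)
    (hdev : ∀ q, T.deviation s q * Ψ = 0)
    (hdef : expectation (Ψ * Ψ.conjTranspose) (T.defect q) = 0) :
    (T.bob q.1.1 - T.bob q.1.2) * (T.bob q.1.1 - T.bob q.1.2) * (T.bob q.1.1 - T.bob q.1.2) * Ψ =
      (1 - s q.1.1 q.1.2) • ((T.bob q.1.1 - T.bob q.1.2) * Ψ) := by
  have h0 := T.smul_diff_mul hdev q
  have hthird := third_outcome_mul_eq_zero (T.one_posSemidef q) (T.two_posSemidef q)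
    (T.bot_posSemidef q) hdef
  have hdef' := mul_eq_zero_of_trace_re_eq_zero (T.defect_posSemidef q) hdef
  have hc : √(1 - s q.1.1 q.1.2) ≠ 0 := (Real.sqrt_pos.2 (by linarith)).ne'
  have hcc : √(1 - s q.1.1 q.1.2) * √(1 - s q.1.1 q.1.2) = 1 - s q.1.1 q.1.2 :=
    Real.mul_self_sqrt (by linarith)
  rw [← hcc]
  generalize √(1 - s q.1.1 q.1.2) = c at *
  have hD : Commute (T.one q - T.two q) (T.bob q.1.1 - T.bob q.1.2) :=
    (T.commute_diff q q.1.1).sub_right (T.commute_diff q q.1.2)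
  have hS : Commute (T.one q + T.two q) (T.bob q.1.1 - T.bob q.1.2) :=
    ((T.commute_one q q.1.1).add_left (T.commute_two q q.1.1)).sub_right
      ((T.commute_one q q.1.2).add_left (T.commute_two q q.1.2))
  have hbot : (1 : Matrix n n ℂ) - T.one q - T.two q = 1 - (T.one q + T.two q) := sub_sub _ _ _
  rw [hbot] at hthird
  rw [defect] at hdef'
  generalize T.one q - T.two q = D at *
  generalize T.bob q.1.1 - T.bob q.1.2 = Y at *
  generalize T.one q + T.two q = S at *
  have hDY : ∀ Z : Matrix n E ℂ, Y * (D * Z) = D * (Y * Z) := fun Z => by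
    rw [← Matrix.mul_assoc, ← hD.eq, Matrix.mul_assoc]
  have hSY : ∀ Z : Matrix n E ℂ, Y * (S * Z) = S * (Y * Z) := fun Z => by
    rw [← Matrix.mul_assoc, ← hS.eq, Matrix.mul_assoc]
  have h1 : S * Ψ = D * (D * Ψ) := by
    rwa [Matrix.sub_mul, sub_eq_zero, Matrix.mul_assoc] at hdef'
  have h2 : D * Ψ = S * (D * Ψ) := by
    rwa [Matrix.sub_mul, sub_eq_zero, Matrix.one_mul] at hthird
  have h3 : c • (S * (D * Ψ)) = c • (D * (D * (D * Ψ))) := by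
    rw [← Matrix.mul_smul, h0, ← hSY, h1, hDY, hDY, ← h0, Matrix.mul_smul, Matrix.mul_smul]
  have h4 : S * (D * Ψ) = D * (D * (D * Ψ)) := by
    have := congrArg (fun Z => c⁻¹ • Z) h3
    simpa only [smul_smul, inv_mul_cancel₀ hc, one_smul] using this
  rw [Matrix.mul_assoc, Matrix.mul_assoc, ← h0, Matrix.mul_smul, hDY, ← h0, Matrix.mul_smul,
    Matrix.mul_smul, Matrix.mul_smul, hDY, hDY, ← h0, Matrix.mul_smul, Matrix.mul_smul, ← h4, ← h2,
    smul_smul]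

theorem bellRelations [Fintype E] (hd : d ≠ 0) (hcomm : ∀ j k, s j k = s k j) (hs1 : ∀ j, s j j = 1)
    (hs : ∀ j k, j ≠ k → s j k < 1) (hΨ : expectation (Ψ * Ψ.conjTranspose) 1 = 1)
    (hval : T.value s (Ψ * Ψ.conjTranspose) = (d : ℝ) ^ 2) :
    BellRelations s d (T.mirror s) T.bob Ψ ∧ ∀ j, T.povm j * (T.bob j * Ψ) = T.povm j * Ψ := by
  have hs' : ∀ j k, s j k ≤ 1 := fun j k => by
    by_cases h : j = k
    · rw [h, hs1]
    · exact (hs j k h).le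
  obtain ⟨hdev, hdef, hidem, hsum, hpovm⟩ := T.eq_zero_of_value_eq hd hΨ hs' hval
  refine ⟨⟨T.mirror_isHermitian s, fun j => (T.bob_posSemidef j).isHermitian, T.commute_mirror s,
    T.bob_mul_eq_mirror_mul hd hdev hsum, hidem, ?_, ?_⟩, hpovm⟩
  · rw [hsum, Complex.coe_smul]
  · intro j k hjk
    rw [← Complex.ofReal_one, ← Complex.ofReal_sub, Complex.coe_smul]
    rcases lt_or_gt_of_ne hjk with h | h
    · exact T.cubic_of_pair ⟨(j, k), h⟩ (hs j k hjk) hdev (hdef ⟨(j, k), h⟩ (hs j k hjk))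
    · have := T.cubic_of_pair ⟨(k, j), h⟩ (hs k j hjk.symm) hdev
        (hdef ⟨(k, j), h⟩ (hs k j hjk.symm))
      rw [hcomm j k, ← neg_sub (T.bob k)]
      simp only [Matrix.neg_mul, Matrix.mul_neg, neg_neg, smul_neg] at this ⊢
      rw [this]

end BellOperators

/-! ### From strategies to operators on the joint space -/

section Strategies

variable {d : ℕ} {A B : Type} [Fintype A] [DecidableEq A] [Fintype B] [DecidableEq B]

theorem kronecker_one_mul_one_kronecker (M : Matrix A A ℂ) (N : Matrix B B ℂ) :
    (M ⊗ₖ (1 : Matrix B B ℂ)) * ((1 : Matrix A A ℂ) ⊗ₖ N) = M ⊗ₖ N := by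
  rw [← Matrix.mul_kronecker_mul, Matrix.mul_one, Matrix.one_mul]

theorem commute_kronecker (M : Matrix A A ℂ) (N : Matrix B B ℂ) :
    Commute (M ⊗ₖ (1 : Matrix B B ℂ)) ((1 : Matrix A A ℂ) ⊗ₖ N) := by
  rw [Commute, SemiconjBy, ← Matrix.mul_kronecker_mul, ← Matrix.mul_kronecker_mul]
  simp

theorem sum_kronecker {ι A B : Type} (t : Finset ι) (M : ι → Matrix A A ℂ) (N : Matrix B B ℂ) :
    ∑ i ∈ t, M i ⊗ₖ N = (∑ i ∈ t, M i) ⊗ₖ N := by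
  ext i j
  simp [Matrix.sum_apply, Finset.sum_mul]

theorem kronecker_sum {ι A B : Type} (t : Finset ι) (M : Matrix A A ℂ) (N : ι → Matrix B B ℂ) :
    ∑ i ∈ t, M ⊗ₖ N i = M ⊗ₖ ∑ i ∈ t, N i := by
  ext i j
  simp [Matrix.sum_apply, Finset.mul_sum]

theorem one_sub_one_kronecker {A B : Type} [DecidableEq A] [DecidableEq B] (N : Matrix B B ℂ) :
    (1 : Matrix (A × B) (A × B) ℂ) - (1 : Matrix A A ℂ) ⊗ₖ N = (1 : Matrix A A ℂ) ⊗ₖ (1 - N) := by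
  rw [sub_eq_iff_eq_add, ← Matrix.kronecker_add, sub_add_cancel, Matrix.one_kronecker_one]

theorem one_sub_kronecker_one {A B : Type} [DecidableEq A] [DecidableEq B] (M : Matrix A A ℂ) :
    (1 : Matrix (A × B) (A × B) ℂ) - M ⊗ₖ (1 : Matrix B B ℂ) = (1 - M) ⊗ₖ (1 : Matrix B B ℂ) := by
  rw [sub_eq_iff_eq_add, ← Matrix.add_kronecker, sub_add_cancel, Matrix.one_kronecker_one]

theorem pairOutcome_bot (S : BICStrategy d A B) (q : Pairs (d ^ 2)) :
    1 - S.alice (.pair q) PairOutcome.one - S.alice (.pair q) PairOutcome.two =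
      S.alice (.pair q) PairOutcome.bot := by
  have h : S.alice (.pair q) PairOutcome.one + (S.alice (.pair q) PairOutcome.two +
      S.alice (.pair q) PairOutcome.bot) = 1 := by
    have h1 := (S.alice_isPOVM (.pair q)).2
    have h2 : ∀ f : PairOutcome → Matrix A A ℂ, ∑ a, f a = f .one + (f .two + f .bot) := fun f => by
      simp [Finset.univ, Fintype.elems]
    -- `AliceOut d (.pair q)` is `PairOutcome` by definition, so the two sums agree definitionally.
    exact (h2 _).symm.trans h1
  rw [← h]; abel

theorem bobOutcome_bot (S : BICStrategy d A B) (j : Fin (d ^ 2)) :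
    1 - S.bob j .one = S.bob j .bot := by
  have h : S.bob j .one + S.bob j .bot = 1 := by
    have h1 := (S.bob_isPOVM j).2
    have h2 : ∀ f : BobOutcome → Matrix B B ℂ, ∑ a, f a = f .one + f .bot := fun f => by
      simp [Finset.univ, Fintype.elems]
    exact (h2 _).symm.trans h1
  rw [← h]; abel

/-- The operators of a strategy on the joint Hilbert space. -/
def Strategy.bellOperators (S : BICStrategy d A B) : BellOperators d (A × B) where
  one q := S.alice (.pair q) PairOutcome.one ⊗ₖ 1
  two q := S.alice (.pair q) PairOutcome.two ⊗ₖ 1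
  bob j := 1 ⊗ₖ S.bob j .one
  povm j := S.alice .povm j ⊗ₖ 1
  one_posSemidef q := ((S.alice_isPOVM _).1 _).kronecker .one
  two_posSemidef q := ((S.alice_isPOVM _).1 _).kronecker .one
  bot_posSemidef q := by
    rw [sub_sub, ← Matrix.add_kronecker, one_sub_kronecker_one, ← sub_sub, pairOutcome_bot]
    exact ((S.alice_isPOVM _).1 _).kronecker .one
  bob_posSemidef j := Matrix.PosSemidef.one.kronecker ((S.bob_isPOVM _).1 _)
  bob_compl_posSemidef j := by
    rw [one_sub_one_kronecker, bobOutcome_bot]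
    exact Matrix.PosSemidef.one.kronecker ((S.bob_isPOVM _).1 _)
  povm_isHermitian j := (((S.alice_isPOVM _).1 _).kronecker .one).isHermitian
  povm_mul_posSemidef j := by
    rw [one_sub_one_kronecker, bobOutcome_bot, kronecker_one_mul_one_kronecker]
    exact ((S.alice_isPOVM _).1 _).kronecker ((S.bob_isPOVM _).1 _)
  povm_sum := by
    refine (sum_kronecker Finset.univ (S.alice .povm) (1 : Matrix B B ℂ)).trans ?_
    refine (congrArg (· ⊗ₖ (1 : Matrix B B ℂ)) (S.alice_isPOVM .povm).2).trans ?_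
    exact Matrix.one_kronecker_one
  commute_one _ _ := commute_kronecker _ _
  commute_two _ _ := commute_kronecker _ _
  commute_povm _ _ := commute_kronecker _ _

theorem Strategy.bellFunction_eq (S : BICStrategy d A B) (s : Fin (d ^ 2) → Fin (d ^ 2) → ℝ) :
    bellFunction s S.correlation = S.bellOperators.value s S.state := by
  have h1 : ∀ x j a b, S.correlation x j a b =
      expectation S.state ((S.alice x a ⊗ₖ 1) * (1 ⊗ₖ S.bob j b)) := fun x j a b => by
    rw [kronecker_one_mul_one_kronecker]; rfl
  have hA : ∀ x j a, ∑ b, S.correlation x j a b =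
      expectation S.state (S.alice x a ⊗ₖ (1 : Matrix B B ℂ)) := fun x j a => by
    rw [Finset.sum_congr rfl fun b _ => h1 x j a b, ← map_sum, ← Finset.mul_sum, kronecker_sum,
      (S.bob_isPOVM j).2, Matrix.one_kronecker_one, mul_one]
  have hB : ∀ x j b, ∑ a, S.correlation x j a b =
      expectation S.state ((1 : Matrix A A ℂ) ⊗ₖ S.bob j b) := fun x j b => by
    rw [Finset.sum_congr rfl fun a _ => h1 x j a b, ← map_sum, ← Finset.sum_mul, sum_kronecker,
      (S.alice_isPOVM x).2, Matrix.one_kronecker_one, one_mul]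
  have hp1 : ∀ q j, S.correlation (.pair q) j PairOutcome.one .one =
      expectation S.state (S.bellOperators.one q * S.bellOperators.bob j) := fun q j => h1 _ _ _ _
  have hp2 : ∀ q j, S.correlation (.pair q) j PairOutcome.two .one =
      expectation S.state (S.bellOperators.two q * S.bellOperators.bob j) := fun q j => h1 _ _ _ _
  have hA1 : ∀ q j, ∑ b, S.correlation (.pair q) j PairOutcome.one b =
      expectation S.state (S.bellOperators.one q) := fun q j => hA _ _ _
  have hA2 : ∀ q j, ∑ b, S.correlation (.pair q) j PairOutcome.two b =
      expectation S.state (S.bellOperators.two q) := fun q j => hA _ _ _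
  have hB1 : ∀ j, ∑ a, S.correlation .povm j a .one =
      expectation S.state (S.bellOperators.bob j) := fun j => hB _ _ _
  have hM : ∀ j : Fin (d ^ 2), S.correlation .povm j j .bot =
      expectation S.state (S.bellOperators.povm j * (1 - S.bellOperators.bob j)) := fun j => by
    refine (h1 _ _ _ _).trans ?_
    rw [← bobOutcome_bot, ← one_sub_one_kronecker]; rfl
  rw [bellFunction, BellOperators.value]
  simp only [hp1, hp2, hA1, hA2, hB1, hM]

end Strategies

/-! ### Optimal strategies and the state of the eavesdropper -/

section Optimal

variable {d : ℕ} {A B E : Type} [Fintype A] [DecidableEq A] [Fintype B] [DecidableEq B]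
  [Fintype E]

theorem expectation_one {n : Type} [Fintype n] [DecidableEq n] {ρ : Matrix n n ℂ} (hρ : IsState ρ) :
    expectation ρ 1 = 1 := by
  rw [expectation_apply, Matrix.one_mul, hρ.2, Complex.one_re]

theorem IsBICPOVM.bellFunction_le {P : Fin (d ^ 2) → Matrix (Fin d) (Fin d) ℂ} (hP : IsBICPOVM d P)
    (S : BICStrategy d A B) : bellFunction (overlap P) S.correlation ≤ (d : ℝ) ^ 2 := by
  -- For the bound any factor V of the state serves as Ψ; no purification is given here.
  obtain ⟨V, hV⟩ := exists_eq_mul_conjTranspose_self S.isState.1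
  have h1 := expectation_one S.isState
  rw [S.bellFunction_eq]
  rw [hV] at h1 ⊢
  refine S.bellOperators.value_le h1 fun j k => ?_
  by_cases h : j = k
  · rw [h, hP.overlap_self]
  · exact (hP.overlap_lt_one h).le

theorem cqState_eq_of_value [DecidableEq E] (hd : d ≠ 0)
    {P : Fin (d ^ 2) → Matrix (Fin d) (Fin d) ℂ}
    (hP : IsBICPOVM d P) (S : BICStrategy d A B) {ψ : (A × B) × E → ℂ}
    (hψ : IsPurification ψ S.state)
    (hval : bellFunction (overlap P) S.correlation = (d : ℝ) ^ 2) :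
    ∃ σ : Matrix E E ℂ, IsState σ ∧ S.cqState .povm ψ = uniformState d ⊗ₖ σ := by
  have hst : S.state = toMatrix ψ * (toMatrix ψ).conjTranspose := by
    rw [← traceRight_ketBra]; exact hψ.symm
  have h1 := expectation_one S.isState
  rw [S.bellFunction_eq, hst] at hval
  rw [hst] at h1
  obtain ⟨hrel, hpovm⟩ := S.bellOperators.bellRelations hd IsBICPOVM.overlap_comm hP.overlap_self
    (fun j k => hP.overlap_lt_one) h1 hval
  have hkey := hrel.compress_eq hd hP S.bellOperators.povm_isHermitian S.bellOperators.commute_povm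
    hpovm S.bellOperators.povm_sum
  -- This σ is the reduced state of E; the transposition is that of `traceLeft_ketBra_mul`.
  refine ⟨((toMatrix ψ).conjTranspose * toMatrix ψ).transpose,
    ⟨(Matrix.posSemidef_conjTranspose_mul_self _).transpose, ?_⟩, ?_⟩
  · rw [Matrix.trace_transpose, Matrix.trace_mul_comm, ← hst, S.isState.2]
  · rw [Strategy.cqState, uniformState, Matrix.smul_kronecker, ← sum_kronecker, Finset.smul_sum]
    refine Finset.sum_congr rfl fun j _ => ?_
    rw [traceLeft_ketBra_mul]
    have := hkey j
    simp only [Strategy.bellOperators] at this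
    rw [this, Matrix.transpose_smul, Matrix.kronecker_smul]

theorem uniformState_eq (d : ℕ) :
    uniformState d = (((1 / (d : ℝ) ^ 2 : ℝ) : ℂ)) • (1 : Matrix (AliceOut d .povm) _ ℂ) := by
  rw [uniformState, Matrix.sum_single_one]
  push_cast
  rfl

theorem condEntropy_uniformState_kronecker [DecidableEq E] (hd : d ≠ 0) {σ : Matrix E E ℂ}
    (hσ : IsState σ) : condEntropy (uniformState d ⊗ₖ σ) = 2 * Real.logb 2 d := by
  have hcard : (Fintype.card (AliceOut d .povm) : ℝ) = (d : ℝ) ^ 2 := by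
    have : Fintype.card (AliceOut d .povm) = d ^ 2 := Fintype.card_fin _
    rw [this]; push_cast; rfl
  have hd' : (d : ℝ) ^ 2 ≠ 0 := by positivity
  have hc : 1 / (d : ℝ) ^ 2 * Fintype.card (AliceOut d .povm) = 1 := by
    rw [hcard, one_div, inv_mul_cancel₀ hd']
  have htr : (uniformState d).trace = 1 := by
    rw [uniformState_eq, Matrix.trace_smul, Matrix.trace_one, smul_eq_mul]
    exact_mod_cast hc
  rw [condEntropy, traceLeft_kronecker, htr, one_smul, uniformState_eq,
    entropy_smul_one_kronecker _ hσ hc, add_sub_cancel_left, hcard, Real.logb_pow]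
  norm_num

end Optimal

/-! ### Spectral projections as polynomials -/

section SpectralProjections

variable {n : Type} [Fintype n] {D : Matrix n n ℂ} {c : ℝ}

/-- The spectral projection for the eigenvalue `c` of a matrix with spectrum in `{c, -c, 0}`. -/
noncomputable def spectralProjection (D : Matrix n n ℂ) (c : ℝ) : Matrix n n ℂ :=
  (2 * (c * c))⁻¹ • (D * D + c • D)

/-- The polynomial (x² + cx) / (2c²) is 1 at c and 0 at -c and 0, so D³ = c² D makes its value at D
a hermitian idempotent. -/
theorem spectralProjection_posSemidef (hD : D.IsHermitian) (hc : c ≠ 0)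
    (h : D * D * D = (c * c) • D) : (spectralProjection D c).PosSemidef := by
  refine posSemidef_of_idempotent ?_ ?_
  · refine BellOperators.isHermitian_real_smul _ (Matrix.IsHermitian.add ?_
      (BellOperators.isHermitian_real_smul _ hD))
    exact (posSemidef_mul_self hD).isHermitian
  · have h1 : (D * D + c • D) * (D * D + c • D) = (2 * (c * c)) • (D * D + c • D) := by
      have h2 : D * (D * D) = (c * c) • D := by rw [← Matrix.mul_assoc, h]
      simp only [Matrix.add_mul, Matrix.mul_add, Matrix.smul_mul, Matrix.mul_smul, Matrix.mul_assoc,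
        h2]
      module
    rw [spectralProjection, Matrix.smul_mul, Matrix.mul_smul, h1, smul_smul (2 * (c * c))⁻¹ (2 * _),
      inv_mul_cancel₀ (by positivity), one_smul]

theorem spectralProjection_neg (D : Matrix n n ℂ) (c : ℝ) :
    spectralProjection D (-c) = (2 * (c * c))⁻¹ • (D * D - c • D) := by
  rw [spectralProjection, neg_mul_neg, neg_smul, sub_eq_add_neg]

theorem spectralProjection_add_neg (hc : c ≠ 0) :
    spectralProjection D c + spectralProjection D (-c) = (c * c)⁻¹ • (D * D) := by
  rw [spectralProjection_neg, spectralProjection, ← smul_add, add_add_sub_cancel, ← two_smul ℝ,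
    smul_smul]
  congr 1
  field_simp

theorem spectralProjection_sub_neg (hc : c ≠ 0) :
    spectralProjection D c - spectralProjection D (-c) = c⁻¹ • D := by
  rw [spectralProjection_neg, spectralProjection, ← smul_sub, add_sub_sub_cancel, ← two_smul ℝ,
    smul_smul, smul_smul]
  congr 1
  field_simp

theorem spectralProjection_compl_posSemidef [DecidableEq n] (hD : D.IsHermitian) (hc : c ≠ 0)
    (h : D * D * D = (c * c) • D) :
    (1 - spectralProjection D c - spectralProjection D (-c)).PosSemidef := by
  rw [sub_sub, spectralProjection_add_neg hc]
  have hh : ((c * c)⁻¹ • (D * D)).IsHermitian :=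
    BellOperators.isHermitian_real_smul _ (posSemidef_mul_self hD).isHermitian
  refine posSemidef_of_idempotent (Matrix.isHermitian_one.sub hh) ?_
  have h1 : ((c * c)⁻¹ • (D * D)) * ((c * c)⁻¹ • (D * D)) = (c * c)⁻¹ • (D * D) := by
    rw [Matrix.smul_mul, Matrix.mul_smul, ← Matrix.mul_assoc, h, Matrix.smul_mul,
      smul_smul (c * c)⁻¹ (c * c), inv_mul_cancel₀ (by positivity), one_smul]
  rw [Matrix.mul_sub, Matrix.mul_one, Matrix.sub_mul, Matrix.one_mul, h1]
  abel

end SpectralProjections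

/-! ### The ideal strategy and its value -/

section Ideal

variable {d : ℕ}

/-- The maximally entangled vector of `ℂ^d ⊗ ℂ^d`. -/
noncomputable def maxEntangled (d : ℕ) : Fin d × Fin d → ℂ :=
  fun i => if i.1 = i.2 then ((√(d : ℝ))⁻¹ : ℂ) else 0

/-- The transposition here is why Alice's ideal effects are transposed: her correlations with Bob
then become plain traces of products. -/
theorem trace_kronecker_mul_maxEntangled (M N : Matrix (Fin d) (Fin d) ℂ) :
    ((M ⊗ₖ N) * ketBra (maxEntangled d)).trace = (d : ℂ)⁻¹ * (M.transpose * N).trace := by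
  have hsq : ((√(d : ℝ))⁻¹ : ℂ) * ((√(d : ℝ))⁻¹ : ℂ) = (d : ℂ)⁻¹ := by
    rw [← mul_inv, ← Complex.ofReal_mul, Real.mul_self_sqrt (Nat.cast_nonneg d)]
    simp
  have htr : (d : ℂ)⁻¹ * (M.transpose * N).trace = ∑ i, ∑ j, (d : ℂ)⁻¹ * (M i j * N i j) := by
    simp only [Matrix.trace, Matrix.diag, Matrix.mul_apply, Matrix.transpose_apply, Finset.mul_sum]
    exact Finset.sum_comm
  rw [htr]
  simp only [ketBra, Matrix.trace, Matrix.diag, Matrix.mul_apply, Matrix.vecMulVec_apply,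
    Fintype.sum_prod_type, maxEntangled, Matrix.kronecker_apply, Pi.star_apply]
  refine Finset.sum_congr rfl fun i _ => ?_
  rw [Finset.sum_eq_single i]
  · refine Finset.sum_congr rfl fun j _ => ?_
    rw [Finset.sum_eq_single j]
    · simp only [if_true]
      rw [← hsq]
      simp
      ring
    · intro k _ hk; simp [Ne.symm hk]
    · simp
  · intro k _ hk; simp [Ne.symm hk]
  · simp

theorem expectation_kronecker_maxEntangled (M N : Matrix (Fin d) (Fin d) ℂ) :
    expectation (ketBra (maxEntangled d)) (M.transpose ⊗ₖ N) = (d : ℝ)⁻¹ * (M * N).trace.re := by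
  rw [expectation_apply, trace_kronecker_mul_maxEntangled, Matrix.transpose_transpose,
    ← Complex.ofReal_natCast, ← Complex.ofReal_inv, Complex.re_ofReal_mul]

theorem isState_maxEntangled (hd : d ≠ 0) : IsState (ketBra (maxEntangled d)) := by
  refine ⟨Matrix.posSemidef_vecMulVec_self_star _, ?_⟩
  have := trace_kronecker_mul_maxEntangled (1 : Matrix (Fin d) (Fin d) ℂ) 1
  rw [Matrix.one_kronecker_one, Matrix.one_mul] at this
  rw [this]
  simp [hd]

namespace IsBICPOVM

variable {P : Fin (d ^ 2) → Matrix (Fin d) (Fin d) ℂ}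

/-- The effects of Alice's ideal measurement for the pair `q`, up to transposition. -/
noncomputable def pairEffect (P : Fin (d ^ 2) → Matrix (Fin d) (Fin d) ℂ) (q : Pairs (d ^ 2)) :
    PairOutcome → Matrix (Fin d) (Fin d) ℂ
  | .one => spectralProjection (P q.1.1 - P q.1.2) √(1 - overlap P q.1.1 q.1.2)
  | .two => spectralProjection (P q.1.1 - P q.1.2) (-√(1 - overlap P q.1.1 q.1.2))
  | .bot => 1 - spectralProjection (P q.1.1 - P q.1.2) √(1 - overlap P q.1.1 q.1.2) -
      spectralProjection (P q.1.1 - P q.1.2) (-√(1 - overlap P q.1.1 q.1.2))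

/-- Alice's ideal measurements. -/
noncomputable def idealAlice (P : Fin (d ^ 2) → Matrix (Fin d) (Fin d) ℂ) :
    ∀ x : AliceSetting d, AliceOut d x → Matrix (Fin d) (Fin d) ℂ
  | .pair q => fun a : PairOutcome => (pairEffect P q a).transpose
  | .povm => fun j : Fin (d ^ 2) => ((d : ℝ)⁻¹ • P j).transpose

/-- Bob's ideal measurements. -/
def idealBob (P : Fin (d ^ 2) → Matrix (Fin d) (Fin d) ℂ) (j : Fin (d ^ 2)) :
    BobOutcome → Matrix (Fin d) (Fin d) ℂ
  | .one => P j
  | .bot => 1 - P j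

theorem sub_isHermitian (hP : IsBICPOVM d P) (j k : Fin (d ^ 2)) : (P j - P k).IsHermitian :=
  (hP.isHermitian j).sub (hP.isHermitian k)

theorem sqrt_one_sub_overlap_ne_zero (hP : IsBICPOVM d P) (q : Pairs (d ^ 2)) :
    √(1 - overlap P q.1.1 q.1.2) ≠ 0 :=
  (Real.sqrt_pos.2 (by linarith [hP.overlap_lt_one q.2.ne])).ne'

theorem sqrt_mul_self_one_sub_overlap (hP : IsBICPOVM d P) (q : Pairs (d ^ 2)) :
    √(1 - overlap P q.1.1 q.1.2) * √(1 - overlap P q.1.1 q.1.2) = 1 - overlap P q.1.1 q.1.2 :=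
  Real.mul_self_sqrt (by linarith [hP.overlap_lt_one q.2.ne])

/-- Follows from P_j P_k P_j = s_jk P_j. It confines the spectrum of P_j - P_k to 0 and ±√(1 -
s_jk). -/
theorem sub_cubic (hP : IsBICPOVM d P) (j k : Fin (d ^ 2)) : (P j - P k) * (P j - P k) *
    (P j - P k) =
    (1 - overlap P j k) • (P j - P k) := by
  have h1 : (P j - P k) * (P j - P k) * (P j - P k) = P j * P j * P j - P j * P j * P k -
      P j * P k * P j + P j * (P k * P k) - P k * (P j * P j) + P k * P j * P k + P k * P k * P j -
      P k * P k * P k := by noncomm_ring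
  rw [h1]
  simp only [hP.idempotent, hP.mul_mul_self_eq_overlap, overlap_comm k j, Complex.coe_smul]
  module

theorem pairEffect_posSemidef (hP : IsBICPOVM d P) (q : Pairs (d ^ 2)) (a : PairOutcome) :
    (pairEffect P q a).PosSemidef := by
  have hc := hP.sqrt_one_sub_overlap_ne_zero q
  have h3 := hP.sub_cubic q.1.1 q.1.2
  rw [← hP.sqrt_mul_self_one_sub_overlap q] at h3
  have hh := hP.sub_isHermitian q.1.1 q.1.2
  cases a
  · exact spectralProjection_posSemidef hh hc h3
  · exact spectralProjection_posSemidef hh (neg_ne_zero.2 hc) (by rw [neg_mul_neg, h3])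
  · exact spectralProjection_compl_posSemidef hh hc h3

theorem idealAlice_isPOVM (hP : IsBICPOVM d P) (hd : d ≠ 0) (x : AliceSetting d) : IsPOVM
    (idealAlice P x) := by
  cases x with
  | pair q =>
    refine ⟨fun a => (hP.pairEffect_posSemidef q a).transpose, ?_⟩
    have h2 : ∀ f : PairOutcome → Matrix (Fin d) (Fin d) ℂ,
        ∑ a, f a = f .one + (f .two + f .bot) := fun f => by simp [Finset.univ, Fintype.elems]
    have h3 : ∑ a, (pairEffect P q a).transpose = 1 := by
      rw [h2, ← Matrix.transpose_one, ← Matrix.transpose_add, ← Matrix.transpose_add]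
      congr 1
      simp only [pairEffect]
      abel
    exact h3
  | povm =>
    refine ⟨fun j => (((posSemidef_of_idempotent (hP.isHermitian j) (hP.idempotent j)).smul
      (by positivity : (0 : ℝ) ≤ (d : ℝ)⁻¹))).transpose, ?_⟩
    have h1 : ∑ j : Fin (d ^ 2), ((d : ℝ)⁻¹ • P j).transpose = 1 := by
      rw [← Matrix.transpose_sum, ← Finset.smul_sum, hP.sum_eq, ← Complex.coe_smul, smul_smul]
      have : (((d : ℝ)⁻¹ : ℝ) : ℂ) * (d : ℂ) = 1 := by
        push_cast
        exact inv_mul_cancel₀ (by exact_mod_cast hd)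
      rw [this, one_smul, Matrix.transpose_one]
    exact h1

theorem idealBob_isPOVM (hP : IsBICPOVM d P) (j : Fin (d ^ 2)) : IsPOVM (idealBob P j) := by
  constructor
  · intro b
    cases b
    · exact posSemidef_of_idempotent (hP.isHermitian j) (hP.idempotent j)
    · refine posSemidef_of_idempotent (Matrix.isHermitian_one.sub (hP.isHermitian j)) ?_
      simp only [idealBob]
      noncomm_ring [hP.idempotent]
  · simp [Finset.univ, Fintype.elems, idealBob]

/-- The ideal strategy, with the maximally entangled state. -/
noncomputable def idealStrategy (hP : IsBICPOVM d P) (hd : d ≠ 0) : BICStrategy d (Fin d)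
    (Fin d) where
  state := ketBra (maxEntangled d)
  alice := idealAlice P
  bob := idealBob P
  isState := isState_maxEntangled hd
  alice_isPOVM := hP.idealAlice_isPOVM hd
  bob_isPOVM := hP.idealBob_isPOVM

theorem sum_pairs_one_sub_overlap (hP : IsBICPOVM d P) :
    2 * ∑ q : Pairs (d ^ 2), (1 - overlap P q.1.1 q.1.2) = (d : ℝ) ^ 4 - (d : ℝ) ^ 3 := by
  rw [two_mul_sum_pairs (fun j k => 1 - overlap P j k) (fun j => by rw [hP.overlap_self, sub_self])
    (fun j k => by rw [overlap_comm])]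
  simp only [Finset.sum_sub_distrib, hP.sum_overlap, Finset.sum_const, Finset.card_univ,
    Fintype.card_fin, nsmul_eq_mul]
  push_cast
  ring

/-- Each pair contributes (4/d - 2/d)(1 - s_jk). By `sum_pairs_one_sub_overlap` the pairs give d³ -
d² in total, Bob's marginals subtract d²(d - 2), and the last term vanishes since P_j(1 - P_j) = 0.
-/
theorem bellFunction_idealStrategy (hP : IsBICPOVM d P) (hd : d ≠ 0) :
    bellFunction (overlap P) (hP.idealStrategy hd).correlation = (d : ℝ) ^ 2 := by
  have hd' : (d : ℝ) ≠ 0 := by exact_mod_cast hd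
  set ρ := ketBra (maxEntangled d)
  set T := (hP.idealStrategy hd).bellOperators
  rw [Strategy.bellFunction_eq]
  have hq : ∀ q : Pairs (d ^ 2), √(1 - overlap P q.1.1 q.1.2) *
      (expectation ρ (T.one q * T.bob q.1.1) + expectation ρ (T.two q * T.bob q.1.2)
        - expectation ρ (T.one q * T.bob q.1.2) - expectation ρ (T.two q * T.bob q.1.1)) =
      2 * (d : ℝ)⁻¹ * (1 - overlap P q.1.1 q.1.2) := by
    intro q
    have hA : ∀ a : PairOutcome, ∀ j, expectation ρ
        (((pairEffect P q a).transpose ⊗ₖ (1 : Matrix (Fin d) (Fin d) ℂ)) * (1 ⊗ₖ P j)) =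
        (d : ℝ)⁻¹ * (pairEffect P q a * P j).trace.re := fun a j => by
      rw [kronecker_one_mul_one_kronecker, expectation_kronecker_maxEntangled]
    have hc := hP.sqrt_one_sub_overlap_ne_zero q
    have h1 : (pairEffect P q .one - pairEffect P q .two) * (P q.1.1 - P q.1.2) =
        (√(1 - overlap P q.1.1 q.1.2))⁻¹ • ((P q.1.1 - P q.1.2) * (P q.1.1 - P q.1.2)) := by
      simp only [pairEffect]
      rw [spectralProjection_sub_neg hc, Matrix.smul_mul]
    have h2 := congrArg (fun M => (Matrix.trace M).re) h1
    simp only [Matrix.trace_smul, hP.trace_sub_mul_self, Complex.smul_re] at h2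
    have h3 : (2 * (1 - (overlap P q.1.1 q.1.2 : ℂ))).re = 2 * (1 - overlap P q.1.1 q.1.2) := by
      simp
    rw [h3, smul_eq_mul] at h2
    simp only [Matrix.sub_mul, Matrix.mul_sub, Matrix.trace_sub, Complex.sub_re] at h2
    have e1 : expectation ρ (T.one q * T.bob q.1.1) = _ := hA .one q.1.1
    have e2 : expectation ρ (T.two q * T.bob q.1.2) = _ := hA .two q.1.2
    have e3 : expectation ρ (T.one q * T.bob q.1.2) = _ := hA .one q.1.2
    have e4 : expectation ρ (T.two q * T.bob q.1.1) = _ := hA .two q.1.1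
    rw [e1, e2, e3, e4]
    have h4 : √(1 - overlap P q.1.1 q.1.2) * ((√(1 - overlap P q.1.1 q.1.2))⁻¹ *
        (2 * (1 - overlap P q.1.1 q.1.2))) = 2 * (1 - overlap P q.1.1 q.1.2) := by
      rw [← mul_assoc, mul_inv_cancel₀ hc, one_mul]
    rw [← h2] at h4
    linear_combination (d : ℝ)⁻¹ * h4
  have hq' : ∀ q : Pairs (d ^ 2), (1 - overlap P q.1.1 q.1.2) *
      (expectation ρ (T.one q) + expectation ρ (T.two q)) =
      2 * (d : ℝ)⁻¹ * (1 - overlap P q.1.1 q.1.2) := by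
    intro q
    have hA : ∀ a : PairOutcome, expectation ρ
        ((pairEffect P q a).transpose ⊗ₖ (1 : Matrix (Fin d) (Fin d) ℂ)) =
        (d : ℝ)⁻¹ * (pairEffect P q a).trace.re := fun a => by
      rw [expectation_kronecker_maxEntangled, Matrix.mul_one]
    have hc := hP.sqrt_one_sub_overlap_ne_zero q
    have h1 : pairEffect P q .one + pairEffect P q .two =
        (1 - overlap P q.1.1 q.1.2)⁻¹ • ((P q.1.1 - P q.1.2) * (P q.1.1 - P q.1.2)) := by
      simp only [pairEffect]
      rw [spectralProjection_add_neg hc, hP.sqrt_mul_self_one_sub_overlap]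
    have h2 := congrArg (fun M => (Matrix.trace M).re) h1
    simp only [Matrix.trace_smul, hP.trace_sub_mul_self, Complex.smul_re, Matrix.trace_add,
      Complex.add_re] at h2
    have h3 : (2 * (1 - (overlap P q.1.1 q.1.2 : ℂ))).re = 2 * (1 - overlap P q.1.1 q.1.2) := by
      simp
    have hne : 1 - overlap P q.1.1 q.1.2 ≠ 0 := by linarith [hP.overlap_lt_one q.2.ne]
    rw [h3, smul_eq_mul] at h2
    have e1 : expectation ρ (T.one q) = _ := hA .one
    have e2 : expectation ρ (T.two q) = _ := hA .two
    rw [e1, e2, ← mul_add, h2]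
    field_simp
  have hb : ∀ j, expectation ρ (T.bob j) = (d : ℝ)⁻¹ := by
    intro j
    have := expectation_kronecker_maxEntangled (1 : Matrix (Fin d) (Fin d) ℂ) (P j)
    rw [Matrix.transpose_one, Matrix.one_mul, hP.trace_eq_one, Complex.one_re, mul_one] at this
    exact this
  have hm : ∀ j, expectation ρ (T.povm j * (1 - T.bob j)) = 0 := by
    intro j
    have h1 : expectation ρ ((((d : ℝ)⁻¹ • P j).transpose ⊗ₖ (1 : Matrix (Fin d) (Fin d) ℂ)) *
        (1 - 1 ⊗ₖ P j)) = 0 := by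
      rw [one_sub_one_kronecker, kronecker_one_mul_one_kronecker,
        expectation_kronecker_maxEntangled, Matrix.mul_sub, Matrix.mul_one, Matrix.smul_mul,
        hP.idempotent]
      simp
    exact h1
  have hsum := hP.sum_pairs_one_sub_overlap
  change T.value (overlap P) ρ = _
  rw [BellOperators.value]
  simp only [hq, hq', hb, hm, ← Finset.mul_sum, Finset.sum_const, Finset.card_univ,
    Fintype.card_fin, nsmul_eq_mul, smul_zero]
  push_cast
  field_simp
  linear_combination hsum

end IsBICPOVM

end Ideal

/-! ### Existence of BIC-POVMs from Weyl–Heisenberg orbits -/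

section Weyl

variable {d : ℕ} [NeZero d]

/-- The values `∑ₖ f(k+m) conj(f(k)) χ(kn)` whose nonvanishing makes the Weyl–Heisenberg orbit of
`f` informationally complete. -/
noncomputable def ambiguity (f : ZMod d → ℂ) (m n : ZMod d) : ℂ :=
  ∑ k, f (k + m) * star (f k) * ZMod.stdAddChar (k * n)

theorem star_stdAddChar (x : ZMod d) : star (ZMod.stdAddChar x) = ZMod.stdAddChar (-x) := by
  rw [AddChar.map_neg_eq_conj]; rfl

theorem sum_stdAddChar_mul (x : ZMod d) :
    ∑ b : ZMod d, ZMod.stdAddChar (b * x) = if x = 0 then (d : ℂ) else 0 := by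
  rw [AddChar.sum_mulShift x (ZMod.isPrimitive_stdAddChar d), ZMod.card]
  split_ifs <;> simp

theorem eq_zero_of_sum_mul_stdAddChar {h : ZMod d → ℂ}
    (hh : ∀ n, ∑ a, h a * ZMod.stdAddChar (a * n) = 0) : h = 0 := by
  refine ZMod.dft.injective ?_
  ext n
  rw [ZMod.dft_apply, map_zero, Pi.zero_apply, ← hh (-n)]
  refine Finset.sum_congr rfl fun a _ => ?_
  rw [smul_eq_mul, mul_comm, mul_neg]

/-- Perturb the delta function by t u. Each value of the ambiguity function is a quadratic
polynomial in t, with constant term 1 at m = 0 and nonzero linear coefficient L at m ≠ 0. Finitely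
many nonzero polynomials have a common non-root t, and scaling then normalises the vector. -/
theorem exists_fiducial (d : ℕ) [NeZero d] :
    ∃ f : ZMod d → ℂ, ∑ k, f k * star (f k) = 1 ∧ ∀ m n, ambiguity f m n ≠ 0 := by
  set u : ZMod d → ℂ := fun k => if k = 0 then 0 else ((k.val : ℂ) + 1) * (2 + Complex.I) with hu
  set δ : ZMod d → ℂ := fun k => if k = 0 then 1 else 0 with hδ
  set L : ZMod d → ZMod d → ℂ := fun m n =>
    u m + star (u (-m)) * ZMod.stdAddChar (-m * n) with hL
  have hexp : ∀ (t : ℝ) m n, ambiguity (fun k => δ k + t * u k) m n =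
      δ m + t * L m n + t ^ 2 * ambiguity u m n := by
    intro t m n
    have h1 : ∑ k, δ (k + m) * star (δ k) * ZMod.stdAddChar (k * n) = δ m := by
      rw [Finset.sum_eq_single 0]
      · simp [hδ]
      · intro k _ hk; simp [hδ, hk]
      · simp
    have h2 : ∑ k, u (k + m) * star (δ k) * ZMod.stdAddChar (k * n) = u m := by
      rw [Finset.sum_eq_single 0]
      · simp [hδ]
      · intro k _ hk; simp [hδ, hk]
      · simp
    have h3 : ∑ k, δ (k + m) * star (u k) * ZMod.stdAddChar (k * n) =
        star (u (-m)) * ZMod.stdAddChar (-m * n) := by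
      rw [Finset.sum_eq_single (-m)]
      · simp [hδ]
      · intro k _ hk
        have : k + m ≠ 0 := fun h => hk (eq_neg_of_add_eq_zero_left h)
        simp [hδ, this]
      · simp
    rw [hL]
    dsimp only
    rw [mul_add, ← h3, ← h1]
    conv_rhs => rw [← h2]
    simp only [ambiguity, Finset.mul_sum, ← Finset.sum_add_distrib]
    refine Finset.sum_congr rfl fun k _ => ?_
    simp
    ring
  have hnz : ∀ m n, δ m ≠ 0 ∨ L m n ≠ 0 := by
    intro m n
    by_cases hm : m = 0
    · left; simp [hδ, hm]
    right
    have hm' : -m ≠ 0 := neg_ne_zero.2 hm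
    intro h0
    simp only [hL, hu, hm, hm', if_false] at h0
    -- If m = -m, the character is ±1 and L is twice the real or twice the imaginary part of u(m)
    -- (times i). The factor 2 + i makes both nonzero.
    by_cases hmm : m = -m
    · have hχ : ZMod.stdAddChar (-m * n) * ZMod.stdAddChar (-m * n) = (1 : ℂ) := by
        rw [← AddChar.map_add_eq_mul]
        have : -m * n + -m * n = 0 := by
          nth_rewrite 1 [← hmm]; ring
        rw [this, AddChar.map_zero_eq_one]
      rw [← hmm] at h0 hχ
      generalize m.val = v at h0
      have hv : ((v : ℂ) + 1) ≠ 0 := Nat.cast_add_one_ne_zero v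
      rcases mul_self_eq_one_iff.1 hχ with h1 | h1 <;> rw [h1] at h0
      · have : ((v : ℂ) + 1) * 4 = 0 := by
          rw [← h0]; simp; ring
        simp [hv] at this
      · have : ((v : ℂ) + 1) * (2 * Complex.I) = 0 := by
          rw [← h0]; simp; ring
        simp [hv] at this
    -- If m ≠ -m, the factors `val + 1` give u(m) and u(-m) different absolute values, so the two
    -- terms of L cannot cancel.
    · have h1 := congrArg (fun z => ‖z‖) (eq_neg_of_add_eq_zero_left h0)
      simp only [norm_neg, norm_mul, norm_star, AddChar.norm_apply, mul_one] at h1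
      have h2 : ‖(2 + Complex.I : ℂ)‖ ≠ 0 := by
        rw [norm_ne_zero_iff]
        intro h
        simpa using congrArg Complex.re h
      have h3 := mul_right_cancel₀ h2 h1
      have h4 : ∀ k : ℕ, ‖((k : ℂ) + 1)‖ = (k : ℝ) + 1 := fun k => by
        rw [← Nat.cast_succ, Complex.norm_natCast]; push_cast; rfl
      rw [h4, h4] at h3
      exact hmm (ZMod.val_injective d (by exact_mod_cast add_right_cancel h3))
  obtain ⟨t, ht⟩ : ∃ t : ℝ, ∀ m n, δ m + t * L m n + t ^ 2 * ambiguity u m n ≠ 0 := by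
    set p : ZMod d × ZMod d → Polynomial ℂ := fun z => Polynomial.C (δ z.1) +
      Polynomial.X * Polynomial.C (L z.1 z.2) + Polynomial.X ^ 2 * Polynomial.C
        (ambiguity u z.1 z.2)
      with hp
    have hp0 : ∏ z, p z ≠ 0 := by
      refine Finset.prod_ne_zero_iff.2 fun z _ h => ?_
      rcases hnz z.1 z.2 with h1 | h1
      · apply h1
        simpa [hp] using congrArg (fun r => Polynomial.coeff r 0) h
      · apply h1
        simpa [hp, Polynomial.coeff_X_pow_mul', Polynomial.coeff_C] using
          congrArg (fun r => Polynomial.coeff r 1) h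
    by_contra! hcon
    refine hp0 (Polynomial.eq_zero_of_infinite_isRoot _ ?_)
    refine (Set.infinite_range_of_injective Complex.ofReal_injective).mono ?_
    rintro _ ⟨t, rfl⟩
    obtain ⟨m, n, hmn⟩ := hcon t
    rw [Set.mem_ofPred_eq, Polynomial.IsRoot, Polynomial.eval_prod]
    refine Finset.prod_eq_zero (Finset.mem_univ (m, n)) ?_
    rw [← hmn]
    simp [hp]
    ring
  set g : ZMod d → ℂ := fun k => δ k + t * u k with hg
  have hN : 0 < ∑ k, ‖g k‖ ^ 2 := by
    refine Finset.sum_pos' (fun k _ => by positivity) ⟨0, Finset.mem_univ _, ?_⟩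
    simp [hg, hδ, hu]
  set N : ℝ := √(∑ k, ‖g k‖ ^ 2) with hNd
  have hN0 : (N : ℂ) ≠ 0 := by exact_mod_cast (Real.sqrt_pos.2 hN).ne'
  have hNN : (N : ℂ) * N = ∑ k, g k * star (g k) := by
    rw [← Complex.ofReal_mul, hNd, Real.mul_self_sqrt hN.le]
    push_cast
    exact Finset.sum_congr rfl fun k _ => (Complex.mul_conj' (g k)).symm
  refine ⟨fun k => (N : ℂ)⁻¹ * g k, ?_, fun m n => ?_⟩
  · have : ∀ k, (N : ℂ)⁻¹ * g k * star ((N : ℂ)⁻¹ * g k) = (N * N : ℂ)⁻¹ * (g k * star (g k)) := by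
      intro k
      simp
      ring
    simp only [this, ← Finset.mul_sum, ← hNN]
    exact inv_mul_cancel₀ (mul_ne_zero hN0 hN0)
  · have : ambiguity (fun k => (N : ℂ)⁻¹ * g k) m n = (N * N : ℂ)⁻¹ * ambiguity g m n := by
      simp only [ambiguity, Finset.mul_sum]
      refine Finset.sum_congr rfl fun k _ => ?_
      simp
      ring
    rw [this]
    refine mul_ne_zero (inv_ne_zero (mul_ne_zero hN0 hN0)) ?_
    rw [hg, hexp]
    exact ht m n

/-- The vector `X^a Z^b f` of the Weyl–Heisenberg orbit of `f`, up to a phase. -/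
noncomputable def weylVector {ι : Type} (e : ι → ZMod d) (f : ZMod d → ℂ) (z : ZMod d × ZMod d) :
    ι → ℂ := fun i => ZMod.stdAddChar (z.2 * e i) * f (e i - z.1)

theorem ketBra_weylVector {ι : Type} (e : ι → ZMod d) (f : ZMod d → ℂ) (z : ZMod d × ZMod d)
    (i j : ι) : ketBra (weylVector e f z) i j =
      ZMod.stdAddChar (z.2 * (e i - e j)) * (f (e i - z.1) * star (f (e j - z.1))) := by
  simp only [ketBra, Matrix.vecMulVec_apply, weylVector, Pi.star_apply, star_mul', star_stdAddChar]
  rw [mul_sub, sub_eq_add_neg (z.2 * e i), AddChar.map_add_eq_mul]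
  ring

theorem star_dotProduct_weylVector {ι : Type} [Fintype ι] (e : ι ≃ ZMod d) {f : ZMod d → ℂ}
    (hf : ∑ k, f k * star (f k) = 1) (z : ZMod d × ZMod d) :
    star (weylVector e f z) ⬝ᵥ weylVector e f z = 1 := by
  have h1 : ∀ i, star (weylVector e f z i) * weylVector e f z i =
      f (e i - z.1) * star (f (e i - z.1)) := fun i => by
    have := ketBra_weylVector e f z i i
    rw [sub_self, mul_zero, AddChar.map_zero_eq_one, one_mul] at this
    rw [← this, mul_comm]; rfl
  simp only [dotProduct, Pi.star_apply, h1]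
  rw [← hf]
  exact Fintype.sum_equiv (e.trans (Equiv.subRight z.1)) _ _ fun i => rfl

/-- On the diagonal of entries (j + m, j) a linear relation is a convolution in j. Its Fourier
transform is the product of a transform of the coefficients with the ambiguity function; dividing by
the latter and inverting both transforms shows that the coefficients vanish. -/
theorem linearIndependent_ketBra_weylVector {ι : Type} (e : ι ≃ ZMod d) {f : ZMod d → ℂ}
    (hf : ∀ m n, ambiguity f m n ≠ 0) :
    LinearIndependent ℂ fun z => ketBra (weylVector e f z) := by
  rw [Fintype.linearIndependent_iff]
  intro c hc
  have h1 : ∀ m j : ZMod d, ∑ a, (∑ b, c (a, b) * ZMod.stdAddChar (b * m)) *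
      (f (j + m - a) * star (f (j - a))) = 0 := by
    intro m j
    have := congrFun (congrFun hc (e.symm (j + m))) (e.symm j)
    rw [Matrix.sum_apply, Fintype.sum_prod_type] at this
    rw [Matrix.zero_apply] at this
    rw [← this]
    refine Finset.sum_congr rfl fun a _ => ?_
    rw [Finset.sum_mul]
    refine Finset.sum_congr rfl fun b _ => ?_
    rw [Matrix.smul_apply, ketBra_weylVector, smul_eq_mul, Equiv.apply_symm_apply,
      Equiv.apply_symm_apply, add_sub_cancel_left, mul_assoc]
  have h2 : ∀ m n : ZMod d,
      ∑ a, (∑ b, c (a, b) * ZMod.stdAddChar (b * m)) * ZMod.stdAddChar (a * n) = 0 := by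
    intro m n
    have h3 : (∑ a, (∑ b, c (a, b) * ZMod.stdAddChar (b * m)) * ZMod.stdAddChar (a * n)) *
        ambiguity f m n = 0 := by
      have h4 : ∑ j : ZMod d, ZMod.stdAddChar (j * n) *
          ∑ a, (∑ b, c (a, b) * ZMod.stdAddChar (b * m)) *
            (f (j + m - a) * star (f (j - a))) = 0 :=
        Finset.sum_eq_zero fun j _ => by rw [h1, mul_zero]
      rw [← h4, Finset.sum_mul]
      simp only [Finset.mul_sum]
      rw [Finset.sum_comm]
      refine Finset.sum_congr rfl fun a _ => ?_
      rw [ambiguity, Finset.mul_sum]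
      refine Fintype.sum_equiv (Equiv.addRight a) _ _ fun k => ?_
      have e1 : k + a + m - a = k + m := by ring
      have e2 : k + a - a = k := by ring
      rw [Equiv.coe_addRight, e1, e2, add_mul k a n, AddChar.map_add_eq_mul]
      ring
    exact (mul_eq_zero.1 h3).resolve_right (hf m n)
  have h5 : ∀ m a, ∑ b, c (a, b) * ZMod.stdAddChar (b * m) = 0 := fun m =>
    congrFun (eq_zero_of_sum_mul_stdAddChar
      (h := fun a => ∑ b, c (a, b) * ZMod.stdAddChar (b * m)) (h2 m))
  rintro ⟨a, b⟩
  exact congrFun (eq_zero_of_sum_mul_stdAddChar (h := fun b => c (a, b)) fun m => h5 m a) b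

/-- Summing over the modulations removes the off-diagonal entries; summing over the translations
gives the norm of f on the diagonal. -/
theorem sum_ketBra_weylVector {ι : Type} [Fintype ι] [DecidableEq ι] (e : ι ≃ ZMod d)
    {f : ZMod d → ℂ} (hf : ∑ k, f k * star (f k) = 1) :
    ∑ z, ketBra (weylVector e f z) = (d : ℂ) • (1 : Matrix ι ι ℂ) := by
  ext i j
  rw [Matrix.sum_apply, Fintype.sum_prod_type]
  simp only [ketBra_weylVector, ← Finset.sum_mul, sum_stdAddChar_mul, sub_eq_zero,
    e.injective.eq_iff, Matrix.smul_apply, Matrix.one_apply, smul_eq_mul]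
  split_ifs with h
  · subst h
    rw [← Finset.mul_sum]
    congr 1
    rw [← hf]
    exact Fintype.sum_equiv (Equiv.subLeft (e i)) _ _ fun i => rfl
  · simp

end Weyl

theorem exists_isBICPOVM {d : ℕ} (hd : d ≠ 0) :
    ∃ P : Fin (d ^ 2) → Matrix (Fin d) (Fin d) ℂ, IsBICPOVM d P := by
  have : NeZero d := ⟨hd⟩
  obtain ⟨f, hf, hamb⟩ := exists_fiducial d
  set e : Fin d ≃ ZMod d := Fintype.equivOfCardEq (by simp)
  set e' : Fin (d ^ 2) ≃ ZMod d × ZMod d := Fintype.equivOfCardEq (by simp [sq])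
  have hli : LinearIndependent ℂ fun j => ketBra (weylVector e f (e' j)) :=
    (linearIndependent_ketBra_weylVector e hamb).comp e' e'.injective
  refine ⟨fun j => ketBra (weylVector e f (e' j)),
    ⟨fun j => ?_, fun j => ?_, fun j => ?_, hli, ?_, ?_⟩⟩
  · exact (Matrix.posSemidef_vecMulVec_self_star _).isHermitian
  · rw [ketBra, Matrix.vecMulVec_mul_vecMulVec, star_dotProduct_weylVector e hf, one_smul]
  · refine le_antisymm (Matrix.rank_vecMulVec_le _ _) (Nat.one_le_iff_ne_zero.2 fun h => ?_)
    refine hli.ne_zero j ?_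
    rw [Matrix.rank, Submodule.finrank_eq_zero, LinearMap.range_eq_bot] at h
    ext i k
    simpa using congrFun (LinearMap.congr_fun h (Pi.single k 1)) i
  · refine hli.span_eq_top_of_card_eq_finrank' ?_
    rw [Module.finrank_matrix]
    simp [sq]
  · rw [← sum_ketBra_weylVector e hf]
    exact Equiv.sum_comp e' fun z => ketBra (weylVector e f z)

/-- A pure state is purified by a trivial system. -/
theorem isPurification_ketBra {m : Type} (φ : m → ℂ) :
    IsPurification (fun z : m × Unit => φ z.1) (ketBra φ) := by
  ext i j
  simp [traceRight, ketBra, Matrix.vecMulVec_apply]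

end DIRandomness

theorem theoremt (d : ℕ) (hd : 2 ≤ d) :
    -- BIC-POVMs exist in dimension `d`
    (∃ P : Fin (d ^ 2) → Matrix (Fin d) (Fin d) ℂ, IsBICPOVM d P) ∧
    (∀ P : Fin (d ^ 2) → Matrix (Fin d) (Fin d) ℂ, IsBICPOVM d P →
      -- the maximal quantum value is `d²`, attained by a locally `d`-dimensional strategy
      IsGreatest (quantumValues (overlap P)) ((d : ℝ) ^ 2) ∧
      (∃ S : BICStrategy d (Fin d) (Fin d),
        bellFunction (overlap P) S.correlation = (d : ℝ) ^ 2) ∧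
      -- for an optimal strategy and any purification, the classical-quantum state factors
      (∀ (A B E : Type) [Fintype A] [DecidableEq A] [Fintype B] [DecidableEq B]
        [Fintype E] [DecidableEq E] (S : BICStrategy d A B) (ψ : (A × B) × E → ℂ),
        IsOptimal (overlap P) S → IsPurification ψ S.state →
          (∃ σ : Matrix E E ℂ, IsState σ ∧ S.cqState .povm ψ = uniformState d ⊗ₖ σ) ∧
          condEntropy (S.cqState .povm ψ) = 2 * Real.logb 2 d) ∧
      -- the maximal value certifies exactly `2 log d` bits
      Certifies {p : Correlation (AliceOut d) (BobOut d) |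
        bellFunction (overlap P) p = (d : ℝ) ^ 2} .povm (2 * Real.logb 2 d) ∧
      IsLeast (rates {p : Correlation (AliceOut d) (BobOut d) |
        bellFunction (overlap P) p = (d : ℝ) ^ 2} .povm) (2 * Real.logb 2 d)) ∧
    -- no correlation of a locally `d`-dimensional strategy, in any Bell scenario, certifies more
    (∀ (X Y : Type) (OA : X → Type) (OB : Y → Type) [∀ x, Fintype (OA x)] [∀ y, Fintype (OB y)]
      (S : Strategy OA OB (Fin d) (Fin d)) (x : X) [DecidableEq (OA x)] (r : ℝ),
      Certifies {S.correlation} x r → r ≤ 2 * Real.logb 2 d) := by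
  have hd0 : d ≠ 0 := by omega
  refine ⟨exists_isBICPOVM hd0, fun P hP => ?_, fun X Y OA OB _ _ S x _ r hr => ?_⟩
  · have hmax : IsGreatest (quantumValues (overlap P)) ((d : ℝ) ^ 2) := by
      refine ⟨⟨Fin d, Fin d, inferInstance, inferInstance, inferInstance, inferInstance,
        hP.idealStrategy hd0, (hP.bellFunction_idealStrategy hd0).symm⟩, ?_⟩
      rintro _ ⟨A, B, _, _, _, _, S, rfl⟩
      exact hP.bellFunction_le S
    have hentropy : ∀ (A B E : Type) [Fintype A] [DecidableEq A] [Fintype B] [DecidableEq B]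
        [Fintype E] [DecidableEq E] (S : BICStrategy d A B) (ψ : (A × B) × E → ℂ),
        bellFunction (overlap P) S.correlation = (d : ℝ) ^ 2 → IsPurification ψ S.state →
        condEntropy (S.cqState .povm ψ) = 2 * Real.logb 2 d := by
      intro A B E _ _ _ _ _ _ S ψ hval hψ
      obtain ⟨σ, hσ, h⟩ := cqState_eq_of_value hd0 hP S hψ hval
      rw [h, condEntropy_uniformState_kronecker hd0 hσ]
    have hcert : Certifies {p : Correlation (AliceOut d) (BobOut d) |
        bellFunction (overlap P) p = (d : ℝ) ^ 2} .povm (2 * Real.logb 2 d) := by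
      rintro _ ⟨A, B, E, _, _, _, _, _, _, S, ψ, hval, hψ, rfl⟩
      exact (hentropy A B E S ψ hval hψ).ge
    refine ⟨hmax, ⟨hP.idealStrategy hd0, hP.bellFunction_idealStrategy hd0⟩, ?_, hcert, ?_, hcert⟩
    · intro A B E _ _ _ _ _ _ S ψ hopt hψ
      -- A set of reals has only one greatest element, so optimality means value d².
      have hval := hopt.unique hmax
      exact ⟨cqState_eq_of_value hd0 hP S hψ hval, hentropy A B E S ψ hval hψ⟩
    -- The minimum is attained by the ideal strategy, whose pure state is purified by a
    -- one-dimensional E.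
    · refine ⟨Fin d, Fin d, Unit, inferInstance, inferInstance, inferInstance, inferInstance,
        inferInstance, inferInstance, hP.idealStrategy hd0, fun z => maxEntangled d z.1,
        hP.bellFunction_idealStrategy hd0, ?_, ?_⟩
      · exact isPurification_ketBra _
      · exact (hentropy _ _ _ _ _ (hP.bellFunction_idealStrategy hd0)
          (isPurification_ketBra _)).symm
  · simpa using Certifies.le_two_mul_logb S x hr
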